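/- **Setting.** Let $r\ge 1$ and $R=r+2$. A $d$-bubble is a finite $d$-regular graph (multiple edges allowed), possibly disconnected, whose edges are coloured with $d$ colours, each colour being incident exactly once at each vertex. For a bubble $\mathcal B$, $c(\mathcal B)$ is the number of its connected components, and $F_{\alpha\beta}(\mathcal B)$ is the number of its $(\alpha\beta)$-faces, i.e. of connected components of the subgraph made of the edges of colours $\alpha,\beta$. For $d\ge 3$ and a cyclic permutation $\sigma$ of all the colours, the jacket $\mathcal J(\mathcal B;\sigma)$ is the embedded (ribbon) graph on the same vertices and edges defined by the signed rotation system with cyclic order $\sigma$ around every vertex and signature $-1$ on every edge. Its genus $g(\mathcal B;\sigma)\in\frac12\mathbb N$ is given by $2c-2g=V-E+F$. Set $\deg\mathcal B=\frac12\sum_\sigma g(\mathcal B;\sigma)$. For $d\ge4$ and a distinguished colour $0$, with $\mathcal B^{(0)}$ obtained by deleting the edges of colour $0$, set $\operatorname{ind}_0\mathcal B=\frac1{(d-3)!}\bigl(\deg\mathcal B-(d-1)\deg\mathcal B^{(0)}\bigr)$. Consider an $\mathrm O(N)^2\times\mathrm O(D)^r$ matrix-tensor model for a real field $(X_{a_1a_2})_{\mu_1\cdots\mu_r}$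 ($1\le a_i\le N$, $1\le\mu_j\le D$) with action $S(X)=\frac{ND^r}{2}X\cdot X+\sum_{a\in\mathcal S}g_a\mathcal I_{\mathcal B_a}(X)$, where $(\mathcal B_a)_{a\in\mathcal S}$ is an arbitrary family of $R$-bubbles: the vertices of $\mathcal B_a$ are the copies of $X$ in $\mathcal I_{\mathcal B_a}$ and an edge of colour $i$ is a contraction of $i$-th indices (colours $1,2$ are the matrix indices). Put $t(\mathcal B_a)=F_{12}(\mathcal B_a)$ and use the enhanced scaling $$g_a=N^{2-t(\mathcal B_a)}D^{\,r+t(\mathcal B_a)-c(\mathcal B_a)+\frac{2}{(r+1)!}\deg\mathcal B_a}\lambda_a .$$ A Feynman graph $\mathcal G$ is a finite collection of (labelled) interaction vertices, indexed by $a\in\mathcal S_{\mathcal G}$, with a complete Wick contraction (pairing) of all their fields. It is connected if the graph formed by the interaction vertices and the propagators is connected (and non-empty). Its coloured representation is the $(R+1)$-bubble $\mathcal B$ made of the interaction bubbles together with the propagators as edges of colour $0$. Let $p$ be the number of propagators, $v$ the number of interaction vertices, $f=F_{01}(\mathcal B)+F_{02}(\mathcal B)$, $\varphi=\sum_{i=3}^{R}F_{0i}(\mathcal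 B)$, and define $$h=2+p-\sum_{a\in\mathcal S_{\mathcal G}}\bigl(2-t(\mathcal B_a)\bigr)-f,$$ $$\frac{\ell}{r+1}=r+h+rp-\sum_{a\in\mathcal S_{\mathcal G}}\Bigl(r+t(\mathcal B_a)-c(\mathcal B_a)+\tfrac{2}{(r+1)!}\deg\mathcal B_a\Bigr)-\varphi .$$ The amplitude $\mathcal A(\mathcal G)(N,D)$ (coupling parameters $\lambda_a$, signs and symmetry factors omitted) is the product of a factor $1/(ND^r)$ per propagator and $g_a/\lambda_a$ per interaction vertex of type $a$, times the number of assignments of values to the indices of all the fields compatible with all contractions and propagators. For a finitely supported $n:\mathcal S\to\mathbb N$, let $F_n(N,D)$ be the coefficient of $\prod_a\lambda_a^{n_a}$ in the perturbative expansion of the free energy $F=-\log Z$ onto connected Feynman graphs, i.e. $F_n(N,D)=w_n\sum_{\mathcal G}\mathcal A(\mathcal G)(N,D)$ with $w_n=-(-1)^{\sum_a n_a}/\prod_a n_a!$, the sum running over the connected Feynman graphs with $n_a$ labelled vertices of each type $a$. Let $F_{n,h}(D)$ be $w_n$ times the sum over those with given $h$ of $\mathcal A(\mathcal G)(1,D)$,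 and let $F_{n,h,\ell}$ be $w_n$ times the number of those with given $h$ and $\ell$. **Theorem.** 1. For every connected Feynman graph $\mathcal G$ and all integers $N,D\ge1$, $\mathcal A(\mathcal G)(N,D)=N^{2-h}D^{\,r+h-\frac{\ell}{r+1}}$, with $h\ge0$ and $$\ell=2\operatorname{ind}_0\mathcal B+(r+1)(r+2)\Bigl[1+\sum_{a\in\mathcal S_{\mathcal G}}\bigl(c(\mathcal B_a)-1\bigr)-c(\mathcal B)\Bigr]\ge0,\qquad \ell\in\mathbb N .$$ In particular the power of $D$ is at most $r+h$. 2. The large $N$ and, at each order in $1/N$, the large $D$ expansions are well-defined: for every $n$, only finitely many $F_{n,h,\ell}$ are non-zero and, for all $N,D\ge1$, $$F_n(N,D)=\sum_{h\in\mathbb N}N^{2-h}F_{n,h}(D),\qquad F_{n,h}(D)=\sum_{\ell\in\mathbb N}D^{\,r+h-\frac{\ell}{r+1}}F_{n,h,\ell}.$$ Moreover, for every $h\in\mathbb N$, $\lim_{N\to\infty}N^{h-2}\bigl(F_n(N,D)-\sum_{j<h}N^{2-j}F_{n,j}(D)\bigr)=F_{n,h}(D)$ for each $D\ge 1$, and $\lim_{D\to\infty}D^{-(r+h)}F_{n,h}(D)=F_{n,h,0}$.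 3. For every connected Feynman graph $\mathcal G$ contributing to $F_n$, every fixed $N\ge1$ and every real $\beta<r+h-\frac{\ell}{r+1}$, $D^{-\beta}|F_n(N,D)|\to\infty$ as $D\to\infty$. 4. The limits $N\to\infty$ and $D\to\infty$ do not commute in general: for every $r\ge1$ there is an $R$-bubble with a single trace such that, in the model having it as its only interaction, for every $k\ge1$, there is a connected Feynman graph with $k$ interaction vertices and $h=\ell=k$ (so that its power of $D$, $r+\frac{r}{r+1}h$, grows linearly with $h$), and for every fixed $N\ge1$, $D^{-r}\,|N^{-2}F_k(N,D)|\to\infty$ as $D\to\infty$, $F_k$ being the coefficient of $\lambda^k$; whereas $\lim_{D\to\infty}D^{-r}\lim_{N\to\infty}N^{-2}F_k(N,D)$ exists and is finite by part 2. -/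

import Mathlib

open Filter Topology

namespace MatTens

noncomputable section

/-! ### Edge-coloured graphs -/

/-- A bubble with colour set `C` (a `d`-bubble if `C` has `d` elements): a finite `d`-regular graph
with properly `d`-coloured edges, each colour being incident exactly once at each vertex.
`edge c v` is the other end of the edge of colour `c` at `v`. Multiple edges are allowed, and
self-loops are excluded by regularity. -/
structure Bubble (C : Type) where
  V : Type
  [fintypeV : Fintype V]
  edge : C → V → V
  edge_edge : ∀ c v, edge c (edge c v) = v
  edge_ne : ∀ c v, edge c v ≠ v

attribute [instance] Bubble.fintypeV

namespace Bubble

variable {C C' : Type}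

/-- The bubble obtained by keeping only the edges with colours in the range of `f`, renamed along
`f`. -/
def restrict (B : Bubble C) (f : C' → C) : Bubble C' where
  V := B.V
  edge c v := B.edge (f c) v
  edge_edge c v := B.edge_edge (f c) v
  edge_ne c v := B.edge_ne (f c) v

/-- The number of connected components of the graph obtained by keeping only the edges with
colours in `A`. -/
def comp (B : Bubble C) (A : Set C) : ℕ :=
  Nat.card (Quot fun v w : B.V => ∃ c ∈ A, B.edge c v = w)

/-- The number of connected components. -/
def numComponents (B : Bubble C) : ℕ := B.comp Set.univ

/-- The number of `(α β)`-faces, for `α ≠ β`: the connected components of the subgraph with colours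
`α` and `β`. -/
def faces (B : Bubble C) (α β : C) : ℕ := B.comp {α, β}

end Bubble

/-! ### Embedded graphs -/

/-- A finite graph embedded in a closed surface, given by a signed rotation system. `H` is the type
of half-edges, `vert` the vertex at which a half-edge is attached, `opp` the other half of the same
edge, `rot` the successor in the clockwise cyclic order around the vertex, `sign` the signature of
the edge (`-1` for a twisted ribbon). Every vertex of interest here has at least one half-edge. -/
structure EmbeddedGraph where
  V : Type
  H : Type
  [fintypeV : Fintype V]
  [fintypeH : Fintype H]
  vert : H → V
  opp : H → H
  opp_opp : ∀ x, opp (opp x) = x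
  opp_ne : ∀ x, opp x ≠ x
  rot : Equiv.Perm H
  rot_cyclic : ∀ x y, vert x = vert y ↔ rot.SameCycle x y
  sign : H → ℤˣ
  sign_opp : ∀ x, sign (opp x) = sign x

namespace EmbeddedGraph

variable (G : EmbeddedGraph)

def numVertices : ℕ := Nat.card G.V

def numEdges : ℕ := Nat.card (Quot fun x y : G.H => G.opp x = y)

def numComponents : ℕ :=
  Nat.card (Quot fun v w : G.V => ∃ x, G.vert x = v ∧ G.vert (G.opp x) = w)

/-- Gluing of the boundary segments of the ribbon graph. `(x, 1)` and `(x, -1)` are the two sides of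
the ribbon at the half-edge `x`, the first facing the successor of `x` and the second facing its
predecessor. Along a ribbon, the side facing the successor at one end is the side facing the
predecessor at the other end if the ribbon is untwisted, and conversely if it is twisted. Around a
vertex, consecutive ribbons are joined by a corner. -/
def sideRel (p q : G.H × ℤˣ) : Prop :=
  q = (G.opp p.1, -(p.2 * G.sign p.1)) ∨ (p.2 = 1 ∧ q = (G.rot p.1, -1))

/-- The number of faces, that is, of boundary components of the ribbon graph. -/
def numFaces : ℕ := Nat.card (Quot G.sideRel)

/-- The genus, summed over connected components and with half-integer values allowed in the
non-orientable case, from Euler's formula `2 c - 2 g = V - E + F`. -/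
def genus : ℝ :=
  G.numComponents - ((G.numVertices : ℝ) - G.numEdges + G.numFaces) / 2

end EmbeddedGraph

/-! ### Jackets, degree, index -/

namespace Bubble

variable {C : Type}

/-- The rotation around the vertices of a jacket: `σ` at unfilled vertices, `σ⁻¹` at filled ones. -/
def jacketRot (B : Bubble C) (σ : Equiv.Perm C) (filled : B.V → Bool) :
    Equiv.Perm (B.V × C) :=
  Equiv.prodShear (Equiv.refl B.V) fun v => if filled v then σ⁻¹ else σ

theorem jacketRot_zpow (B : Bubble C) (σ : Equiv.Perm C) (filled : B.V → Bool) (v : B.V) (n : ℤ)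
    (c : C) : ((B.jacketRot σ filled) ^ n) (v, c) =
      (v, ((if filled v then σ⁻¹ else σ) ^ n) c) := by
  have h1 : ∀ c, (B.jacketRot σ filled) (v, c) = (v, (if filled v then σ⁻¹ else σ) c) :=
    fun c => rfl
  have h2 : ∀ c, (B.jacketRot σ filled)⁻¹ (v, c) = (v, (if filled v then σ⁻¹ else σ)⁻¹ c) := by
    intro c
    rw [Equiv.Perm.inv_eq_iff_eq, h1]
    simp
  induction n generalizing c with
  | zero => simp
  | succ n ih => rw [zpow_add_one, zpow_add_one, Equiv.Perm.mul_apply, h1, ih]; rfl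
  | pred n ih => rw [zpow_sub_one, zpow_sub_one, Equiv.Perm.mul_apply, h2, ih]; rfl

/-- The jacket of a bubble for a cyclic permutation `σ` of all its colours and a partition of its
vertices into filled and unfilled ones: the half-edges are cyclically ordered clockwise
according to `σ` around unfilled vertices and anticlockwise around filled vertices; the signature of
an edge is `-1` if it joins two vertices of the same type and `1` otherwise. -/
def jacket [Fintype C] (B : Bubble C) (σ : Equiv.Perm C) (hσ : σ.IsCycleOn Set.univ)
    (filled : B.V → Bool) : EmbeddedGraph where
  V := B.V
  H := B.V × C
  vert x := x.1
  opp x := (B.edge x.2 x.1, x.2)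
  opp_opp x := by simp [B.edge_edge]
  opp_ne x h := B.edge_ne x.2 x.1 (congrArg Prod.fst h)
  rot := B.jacketRot σ filled
  rot_cyclic := by
    rintro ⟨v, c⟩ ⟨w, e⟩
    constructor
    · rintro (rfl : v = w)
      have h : (if filled v then σ⁻¹ else σ).SameCycle c e := by
        split_ifs
        · exact Equiv.Perm.sameCycle_inv.2 (hσ.2 (Set.mem_univ c) (Set.mem_univ e))
        · exact hσ.2 (Set.mem_univ c) (Set.mem_univ e)
      obtain ⟨n, hn⟩ := h
      exact ⟨n, by rw [jacketRot_zpow, hn]⟩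
    · rintro ⟨n, hn⟩
      rw [jacketRot_zpow] at hn
      exact (Prod.mk.inj hn).1
  sign x := if filled x.1 = filled (B.edge x.2 x.1) then -1 else 1
  sign_opp x := by simp only [B.edge_edge, eq_comm]

open Classical in
/-- The degree: half the sum of the genera of the jackets over all cyclic permutations of the
colours (`σ` and `σ⁻¹` give the same jacket). The jacket does not depend on the choice of filled
vertices, see `genus_jacket`; all vertices are taken unfilled. -/
def deg [Fintype C] (B : Bubble C) : ℝ :=
  (1 / 2) * ∑ σ : {σ : Equiv.Perm C // σ.IsCycleOn Set.univ},
    (B.jacket σ.1 σ.2 fun _ => false).genus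

/-- The index with respect to the distinguished colour `none` (the colour `0`) of a `d`-bubble,
`d = |C| + 1 ≥ 4`. -/
def ind0 [Fintype C] (B : Bubble (Option C)) : ℝ :=
  (1 / ((Fintype.card C - 2).factorial : ℝ)) *
    (B.deg - Fintype.card C * (B.restrict some).deg)

/-- Local switches do not change the genus of a jacket. -/
theorem genus_jacket [Fintype C] (B : Bubble C) (σ : Equiv.Perm C) (hσ : σ.IsCycleOn Set.univ)
    (filled : B.V → Bool) :
    (B.jacket σ hσ filled).genus = (B.jacket σ hσ fun _ => false).genus := by
  have key : (B.jacket σ hσ filled).numFaces = (B.jacket σ hσ fun _ => false).numFaces := by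
    let f : (B.V × C) × ℤˣ → (B.V × C) × ℤˣ :=
      fun p => (p.1, if filled p.1.1 then -p.2 else p.2)
    have ff : ∀ p, f (f p) = p := by
      rintro ⟨⟨v, c⟩, s⟩
      by_cases h : filled v <;> simp [f, h]
    have h1 : ∀ p q, (B.jacket σ hσ filled).sideRel p q →
        Quot.mk (B.jacket σ hσ fun _ => false).sideRel (f p) = Quot.mk _ (f q) := by
      rintro ⟨⟨v, c⟩, s⟩ q (rfl | ⟨h, rfl⟩)
      · refine Quot.sound (Or.inl ?_)
        by_cases h : filled v <;> by_cases h' : filled (B.edge c v) <;>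
          simp [f, jacket, h, h']
      · have h : s = 1 := h
        subst h
        by_cases h' : filled v
        · symm
          refine Quot.sound (Or.inr ⟨?_, ?_⟩)
          · change (if filled v then -(-1) else -1 : ℤˣ) = 1
            simp [h']
          · change (((v, c), if filled v then -1 else 1) : (B.V × C) × ℤˣ) =
              ((v, σ ((if filled v then σ⁻¹ else σ) c)), -1)
            simp [h']
        · refine Quot.sound (Or.inr ⟨?_, ?_⟩)
          · change (if filled v then -1 else 1 : ℤˣ) = 1
            simp [h']
          · change (((v, (if filled v then σ⁻¹ else σ) c), if filled v then -(-1) else -1) :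
              (B.V × C) × ℤˣ) = ((v, σ c), -1)
            simp [h']
    have h2 : ∀ p q, (B.jacket σ hσ fun _ => false).sideRel p q →
        Quot.mk (B.jacket σ hσ filled).sideRel (f p) = Quot.mk _ (f q) := by
      rintro ⟨⟨v, c⟩, s⟩ q (rfl | ⟨h, rfl⟩)
      · refine Quot.sound (Or.inl ?_)
        by_cases h : filled v <;> by_cases h' : filled (B.edge c v) <;>
          simp [f, jacket, h, h']
      · have h : s = 1 := h
        subst h
        by_cases h' : filled v
        · symm
          refine Quot.sound (Or.inr ⟨?_, ?_⟩)
          · change (if filled v then -(-1) else -1 : ℤˣ) = 1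
            simp [h']
          · change (((v, c), if filled v then -1 else 1) : (B.V × C) × ℤˣ) =
              ((v, (if filled v then σ⁻¹ else σ) (σ c)), -1)
            simp [h']
        · refine Quot.sound (Or.inr ⟨?_, ?_⟩)
          · change (if filled v then -1 else 1 : ℤˣ) = 1
            simp [h']
          · change (((v, σ c), if filled v then -(-1) else -1) :
              (B.V × C) × ℤˣ) = ((v, (if filled v then σ⁻¹ else σ) c), -1)
            simp [h']
    refine Nat.card_congr ⟨Quot.lift (fun p => Quot.mk _ (f p)) h1,
      Quot.lift (fun p => Quot.mk _ (f p)) h2, ?_, ?_⟩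
    · rintro ⟨p⟩
      exact congrArg (Quot.mk _) (ff p)
    · rintro ⟨p⟩
      exact congrArg (Quot.mk _) (ff p)
  unfold EmbeddedGraph.genus
  rw [key]
  rfl

end Bubble

/-! ### Matrix-tensor models and their Feynman graphs -/

/-- The colours of the indices of the field `(X_{a₁ a₂})_{μ₁ … μ_r}`: `inl 0` and `inl 1` for the two
matrix indices, `inr i` for the `r` tensor indices. -/
abbrev Colour (r : ℕ) : Type := Fin 2 ⊕ Fin r

variable {r : ℕ}

/-- The number of traces of the invariant of an interaction bubble. -/
def Bubble.traces (B : Bubble (Colour r)) : ℕ := B.faces (Sum.inl 0) (Sum.inl 1)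

/-- The exponent of `D` in the enhanced scaling. -/
def Bubble.dExp (B : Bubble (Colour r)) : ℝ :=
  r + B.traces - B.numComponents + 2 / ((r + 1).factorial : ℝ) * B.deg

/-- The ratio `g / λ` of the coupling constant of an invariant to its coupling parameter
in the enhanced scaling. -/
def Bubble.enhancedScaling (B : Bubble (Colour r)) (N D : ℕ) : ℝ :=
  (N : ℝ) ^ (2 - (B.traces : ℝ)) * (D : ℝ) ^ B.dExp

/-- The range of an index of given colour. -/
def dim (N D : ℕ) : Colour r → ℕ := Sum.elim (fun _ => N) (fun _ => D)

section Graphs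

variable {S : Type}

/-- The interaction vertices at order `∏ a, λ_a ^ (n a)` of perturbation theory: `n a` labelled
vertices of each type `a`. -/
abbrev Vertices (n : S →₀ ℕ) : Type := Σ a : n.support, Fin (n a)

/-- The copies of the field `X` in the invariants attached to the interaction vertices. -/
abbrev Fields (𝓑 : S → Bubble (Colour r)) (n : S →₀ ℕ) : Type :=
  Σ i : Vertices n, (𝓑 i.1).V

/-- A Feynman graph, not necessarily connected, of the model with action
`(N D ^ r / 2) X · X + ∑ a, g_a I_{𝓑 a} (X)`: labelled interaction vertices, and a complete Wick
contraction of the fields attached to them. -/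
@[ext]
structure FeynmanGraph (𝓑 : S → Bubble (Colour r)) (n : S →₀ ℕ) where
  wick : Fields 𝓑 n → Fields 𝓑 n
  wick_wick : ∀ x, wick (wick x) = x
  wick_ne : ∀ x, wick x ≠ x

instance (𝓑 : S → Bubble (Colour r)) (n : S →₀ ℕ) : Finite (FeynmanGraph 𝓑 n) :=
  Finite.of_injective FeynmanGraph.wick fun _ _ h => FeynmanGraph.ext h

instance (𝓑 : S → Bubble (Colour r)) (n : S →₀ ℕ) : Fintype (FeynmanGraph 𝓑 n) :=
  Fintype.ofFinite _

namespace FeynmanGraph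

variable {𝓑 : S → Bubble (Colour r)} {n : S →₀ ℕ} (G : FeynmanGraph 𝓑 n)

/-- Connectedness of the graph whose vertices are the interaction vertices (each of them being a
single vertex, even if its interaction bubble is disconnected) and whose edges are the
propagators. -/
def Connected : Prop :=
  Nat.card (Quot fun i j : Vertices n => ∃ x : Fields 𝓑 n, x.1 = i ∧ (G.wick x).1 = j) = 1

/-- The coloured representation: the bubble made of the interaction bubbles and of the propagators,
the latter having colour `none`. -/
def bubble : Bubble (Option (Colour r)) where
  V := Fields 𝓑 n
  edge c x := match c with
    | none => G.wick x
    | some c => ⟨x.1, (𝓑 x.1.1).edge c x.2⟩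
  edge_edge c x := by
    cases c with
    | none => exact G.wick_wick x
    | some c => simp [Bubble.edge_edge]
  edge_ne c x := by
    cases c with
    | none => exact G.wick_ne x
    | some c =>
      intro h
      exact (𝓑 x.1.1).edge_ne c x.2 (eq_of_heq (Sigma.mk.inj h).2)

/-- The number of propagators. -/
def p : ℕ := Nat.card (Quot fun x y => G.wick x = y)

/-- The number of closed strands carrying matrix indices. -/
def f : ℕ := ∑ m : Fin 2, G.bubble.faces none (some (Sum.inl m))

/-- The number of closed strands carrying tensor indices. -/
def phi : ℕ := ∑ m : Fin r, G.bubble.faces none (some (Sum.inr m))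

/-- The parameter of the large `N` expansion. -/
def h : ℤ := 2 + G.p - ∑ i : Vertices n, (2 - ((𝓑 i.1).traces : ℤ)) - G.f

/-- The parameter of the large `D` expansion. -/
def ell : ℝ :=
  (r + 1) * (r + G.h + r * G.p - ∑ i : Vertices n, (𝓑 i.1).dExp - G.phi)

/-- The assignments of values to the indices of all fields which are compatible with the
contractions in the invariants and with the Kronecker deltas of the propagators. -/
def IndexAssignment (N D : ℕ) : Type :=
  {x : (c : Colour r) → Fields 𝓑 n → Fin (dim N D c) //
    (∀ (c : Colour r) (i : Vertices n) (v : (𝓑 i.1).V), x c ⟨i, (𝓑 i.1).edge c v⟩ = x c ⟨i, v⟩) ∧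
    ∀ (c : Colour r) (y : Fields 𝓑 n), x c (G.wick y) = x c y}

/-- The amplitude, stripped of coupling parameters, sign and symmetry factors, from the Feynman
rules: a factor `1 / (N D ^ r)` for each propagator, the scaling factor of the coupling
constant for each interaction vertex, and a sum over all index values. -/
def amplitude (N D : ℕ) : ℝ :=
  (1 / ((N : ℝ) * (D : ℝ) ^ r)) ^ G.p *
    (∏ i : Vertices n, (𝓑 i.1).enhancedScaling N D) * Nat.card (G.IndexAssignment N D)

end FeynmanGraph

/-- The sign and symmetry factor of the Feynman graphs in the perturbative expansion of
`F = - log Z` at order `∏ a, λ_a ^ (n a)`. -/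
def weight (n : S →₀ ℕ) : ℝ :=
  -((-1) ^ (n.sum fun _ k => k) / (n.prod fun _ k => (k.factorial : ℝ)))

open Classical in
/-- The coefficient of `∏ a, λ_a ^ (n a)` in the perturbative expansion of the free energy onto
connected Feynman graphs. -/
def freeEnergy (𝓑 : S → Bubble (Colour r)) (n : S →₀ ℕ) (N D : ℕ) : ℝ :=
  weight n * ∑ G : FeynmanGraph 𝓑 n with G.Connected, G.amplitude N D

/-- The contribution to the coefficient of `∏ a, λ_a ^ (n a)` of the connected Feynman graphs with
given values of both parameters, without any dependence on `N` and `D`. -/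
def freeEnergyHL (𝓑 : S → Bubble (Colour r)) (n : S →₀ ℕ) (h l : ℕ) : ℝ :=
  weight n * Nat.card {G : FeynmanGraph 𝓑 n // G.Connected ∧ G.h = h ∧ G.ell = l}

open Classical in
/-- The contribution to the coefficient of `∏ a, λ_a ^ (n a)` of the connected Feynman graphs with
a given value of the first parameter, stripped of its dependence on `N` (by setting `N = 1`). -/
def freeEnergyH (𝓑 : S → Bubble (Colour r)) (n : S →₀ ℕ) (h D : ℕ) : ℝ :=
  weight n * ∑ G : FeynmanGraph 𝓑 n with G.Connected ∧ G.h = (h : ℤ), G.amplitude 1 D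

end Graphs

end

end MatTens

open MatTens

/-!
The whole theorem reduces to counting bicoloured faces. Write `F a b` for the number of faces of
colours `a`, `b` of the coloured representation, `p` for the number of propagators, `v` for the
number of interaction vertices.

* A face of a jacket is a bicoloured face whose two colours are consecutive in the cyclic order
  (`Bubble.numFaces_jacket`), and every ordered pair of colours is consecutive in `(d - 2)!` of the
  `(d - 1)!` cyclic orders (`card_isCycleOn_univ_apply_eq`). So the degree is an affine function of
  the sum of all `F a b` (`Bubble.deg_eq`). Inserted into the definitions, this gives the relation
  between `ℓ` and the index (`FeynmanGraph.ell_eq_ind0`), and shows that `ℓ` is half the sum over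
  the ordered pairs `a ≠ b` of colours other than `0` of `F a b + 2 + p - F 0 a - F 0 b - 2 v`. The same
  expression for the two matrix colours is `h`.
* Each of these expressions is nonnegative (`FeynmanGraph.faces_none_add_le`). Indeed the subgraph
  with colours `0`, `a`, `b` is a map on a closed surface, possibly non-orientable, to which Euler's
  inequality applies (`Bubble.euler_le`). The number of its connected components is at most
  `F a b + 1 - v`, because the Feynman graph is connected (`FeynmanGraph.comp_add_card_le`).
  Euler's inequality is proved by linear algebra over the field with two elements, as the
  nonnegativity of the first Betti number of the surface.
* The amplitude is a monomial since the index sums factorize over the faces of colours `0`, `c`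
  (`FeynmanGraph.amplitude_eq`). The expansions are therefore finite sums of monomials, and there
  are no cancellations at a given order of perturbation theory, because all the amplitudes are positive
  and come with the same weight.
* The limits fail to commute for the complete graph on four vertices with all the tensor colours on
  one perfect matching (`tetrahedron`): closed rings of `k` of these have `h = ℓ = k` (`necklace`).
-/

namespace MatTens

/-! ### Classes of an equivalence relation and invariant functions -/

theorem two_mul_card_quot_involution {α : Type} [Finite α] (f : α → α)
    (hf : ∀ x, f (f x) = x) (hne : ∀ x, f x ≠ x) :
    2 * Nat.card (Quot fun x y => f x = y) = Nat.card α := by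
  classical
  have := Fintype.ofFinite α
  have : Fintype (Quot fun x y => f x = y) := Fintype.ofFinite _
  have key : ∀ x y, Quot.mk (fun x y => f x = y) y = Quot.mk _ x → y ∈ ({x, f x} : Finset α) := by
    intro x y h
    let F : Quot (fun x y => f x = y) → Finset α :=
      Quot.lift (fun x => {x, f x}) (by rintro x _ rfl; rw [hf]; exact Finset.pair_comm _ _)
    have h' : ({y, f y} : Finset α) = {x, f x} := congrArg F h
    rw [← h']
    exact Finset.mem_insert_self _ _
  rw [Nat.card_eq_fintype_card, Nat.card_eq_fintype_card, ← Finset.card_univ (α := α),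
    Finset.card_eq_sum_card_fiberwise (f := Quot.mk (fun x y => f x = y)) (t := Finset.univ)
      (fun _ _ => Finset.mem_coe.2 (Finset.mem_univ _))]
  rw [Finset.sum_congr rfl (g := fun _ => 2), Finset.sum_const, Finset.card_univ, smul_eq_mul,
    mul_comm]
  rintro ⟨x⟩ -
  rw [← Finset.card_pair (hne x).symm]
  congr 1
  ext y
  rw [Finset.mem_filter]
  refine ⟨fun h => key x y h.2, fun h => ⟨Finset.mem_univ _, ?_⟩⟩
  rcases Finset.mem_insert.1 h with rfl | h
  · rfl
  · rw [Finset.mem_singleton.1 h]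
    exact (Quot.sound (r := fun x y => f x = y) rfl).symm

/-- The functions on `V` which are constant on the classes of the equivalence relation generated
by `R`. -/
def invariants (K : Type) [Field K] {V : Type} (R : V → V → Prop) : Submodule K (V → K) where
  carrier := {f | ∀ x y, R x y → f x = f y}
  add_mem' hf hg x y h := by simp [hf x y h, hg x y h]
  zero_mem' x y _ := rfl
  smul_mem' k f hf x y h := by simp [hf x y h]

theorem finrank_invariants (K : Type) [Field K] {V : Type} [Finite V] (R : V → V → Prop) :
    Module.finrank K (invariants K R) = Nat.card (Quot R) := by
  have e : invariants K R ≃ₗ[K] (Quot R → K) :=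
    { toFun := fun f => Quot.lift f.1 f.2
      map_add' := by intro f g; ext ⟨x⟩; rfl
      map_smul' := by intro k f; ext ⟨x⟩; rfl
      invFun := fun g => ⟨fun x => g (Quot.mk _ x), fun x y h => congrArg g (Quot.sound h)⟩
      left_inv := by intro f; rfl
      right_inv := by intro g; ext ⟨x⟩; rfl }
  have := Fintype.ofFinite (Quot R)
  rw [e.finrank_eq, Module.finrank_fintype_fun_eq_card, Nat.card_eq_fintype_card]

/-- A graph with vertex set `V` and edge set `E` has at least `|V| - |E|` connected components. -/
theorem card_le_card_edges_add_card_quot {V E : Type} [Finite V] [Finite E] (s t : E → V) :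
    Nat.card V ≤ Nat.card E + Nat.card (Quot fun x y => ∃ e, s e = x ∧ t e = y) := by
  have := Fintype.ofFinite V
  have := Fintype.ofFinite E
  let δ : (V → ℚ) →ₗ[ℚ] (E → ℚ) := LinearMap.funLeft ℚ ℚ s - LinearMap.funLeft ℚ ℚ t
  have hker : LinearMap.ker δ = invariants ℚ fun x y => ∃ e, s e = x ∧ t e = y := by
    ext f
    rw [LinearMap.mem_ker]
    constructor
    · rintro h _ _ ⟨e, rfl, rfl⟩
      exact sub_eq_zero.1 (congrFun h e)
    · intro h
      ext e
      exact sub_eq_zero.2 (h _ _ ⟨e, rfl, rfl⟩)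
  have h1 := LinearMap.finrank_range_add_finrank_ker δ
  have h2 := Submodule.finrank_le (LinearMap.range δ)
  rw [hker, finrank_invariants] at h1
  rw [Module.finrank_fintype_fun_eq_card, ← Nat.card_eq_fintype_card] at h1 h2
  omega

/-! ### Euler's inequality and connectedness -/

namespace Bubble

variable {C : Type} (B : Bubble C)

theorem two_mul_comp_singleton (a : C) : 2 * B.comp {a} = Nat.card B.V := by
  rw [← two_mul_card_quot_involution (B.edge a) (B.edge_edge a) (B.edge_ne a)]
  simp [comp]

/-- The functions on the vertices, with values in the field with two elements, that are constant
along the edges with colours in `A`: the mod 2 chains on the components of the subgraph with colours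
`A`. For `A` with two elements these are the 2-chains of the surface of a 3-coloured graph, for `A`
with a single element the 1-chains spanned by the edges of that colour. -/
abbrev inv (A : Set C) : Submodule (ZMod 2) (B.V → ZMod 2) :=
  invariants (ZMod 2) fun v w => ∃ c ∈ A, B.edge c v = w

theorem finrank_inv (A : Set C) : Module.finrank (ZMod 2) (B.inv A) = B.comp A :=
  finrank_invariants _ _

theorem inv_anti {A A' : Set C} (h : A ⊆ A') : B.inv A' ≤ B.inv A :=
  fun _ hf x y ⟨c, hc, hxy⟩ => hf x y ⟨c, h hc, hxy⟩

theorem single_add_single_mem_inv [DecidableEq B.V] (a : C) (v : B.V) :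
    (Pi.single v 1 + Pi.single (B.edge a v) 1 : B.V → ZMod 2) ∈ B.inv {a} := by
  rintro x _ ⟨c, rfl, rfl⟩
  have h1 : (B.edge c x = v) ↔ (x = B.edge c v) := by
    constructor <;> rintro rfl <;> simp [B.edge_edge]
  have h2 : (B.edge c x = B.edge c v) ↔ (x = v) := by
    constructor
    · intro h; rw [← B.edge_edge c x, h, B.edge_edge]
    · rintro rfl; rfl
  simp only [Pi.add_apply, Pi.single_apply, h1, h2]
  exact add_comm _ _

/-- The sum of the spaces of 1-chains is the space of boundaries in the 0-chains up to the identity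
of `K^V` with its dual: a linear form vanishing on it takes the same value on the two ends of
every edge, hence is a function on the connected components. -/
theorem card_le_finrank_sup (a b c : C) :
    Nat.card B.V ≤
      Module.finrank (ZMod 2) ↥(B.inv {a} ⊔ B.inv {b} ⊔ B.inv {c}) + B.comp {a, b, c} := by
  classical
  set W := B.inv {a} ⊔ B.inv {b} ⊔ B.inv {c} with hW
  have h1 := Subspace.finrank_add_finrank_dualAnnihilator_eq W
  rw [Module.finrank_fintype_fun_eq_card, ← Nat.card_eq_fintype_card] at h1
  rw [← h1]
  gcongr
  rw [← finrank_inv]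
  have hle : ∀ d ∈ ({a, b, c} : Set C), B.inv {d} ≤ W := by
    rintro d (rfl | rfl | rfl)
    · exact le_sup_left.trans le_sup_left
    · exact le_sup_right.trans le_sup_left
    · exact le_sup_right
  let T : W.dualAnnihilator →ₗ[ZMod 2] B.inv {a, b, c} :=
    { toFun := fun φ => ⟨fun v => φ.1 (Pi.single v 1), by
        rintro v _ ⟨d, hd, rfl⟩
        have h := (Submodule.mem_dualAnnihilator φ.1).1 φ.2 _
          (hle d hd (B.single_add_single_mem_inv d v))
        rw [map_add] at h
        exact CharTwo.add_eq_zero.1 h⟩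
      map_add' := fun _ _ => rfl
      map_smul' := fun _ _ => rfl }
  refine LinearMap.finrank_le_finrank_of_injective (f := T) ?_
  intro φ ψ h
  refine Subtype.ext (LinearMap.pi_ext' fun v => LinearMap.ext_ring ?_)
  exact congrFun (congrArg Subtype.val h) v

/-- Nonnegativity of the genus of the closed surface made of the bicoloured faces of a 3-coloured
graph, which may be non-orientable. It follows from the cellular chain complex `d1 ∘ d2 = 0` over
the field with two elements: the kernel of `d2` and the cokernel of `d1` have the number of
connected components as dimension, and the first Betti number is nonnegative. -/
theorem euler_le (a b c : C) :
    2 * (B.faces a b + B.faces b c + B.faces a c) ≤ 4 * B.comp {a, b, c} + Nat.card B.V := by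
  -- the edges of a given colour separate two of the three kinds of faces
  let d2 : (B.inv {a, b} × B.inv {b, c} × B.inv {a, c}) →ₗ[ZMod 2]
      (B.inv {a} × B.inv {b} × B.inv {c}) :=
    { toFun := fun x =>
        (⟨x.1.1 + x.2.2.1, add_mem (B.inv_anti (by simp) x.1.2) (B.inv_anti (by simp) x.2.2.2)⟩,
         ⟨x.1.1 + x.2.1.1, add_mem (B.inv_anti (by simp) x.1.2) (B.inv_anti (by simp) x.2.1.2)⟩,
         ⟨x.2.1.1 + x.2.2.1,
          add_mem (B.inv_anti (by simp) x.2.1.2) (B.inv_anti (by simp) x.2.2.2)⟩)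
      map_add' := by
        intro x y
        ext v <;> simp <;> ring
      map_smul' := by
        intro k x
        ext v <;> simp }
  let d1 : (B.inv {a} × B.inv {b} × B.inv {c}) →ₗ[ZMod 2] (B.V → ZMod 2) :=
    (B.inv {a}).subtype.coprod ((B.inv {b}).subtype.coprod (B.inv {c}).subtype)
  have hle : LinearMap.range d2 ≤ LinearMap.ker d1 := by
    rintro _ ⟨x, rfl⟩
    rw [LinearMap.mem_ker]
    ext v
    change x.1.1 v + x.2.2.1 v + (x.1.1 v + x.2.1.1 v + (x.2.1.1 v + x.2.2.1 v)) = 0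
    generalize x.1.1 v = p, x.2.2.1 v = q, x.2.1.1 v = s
    revert p q s
    decide
  have hr1 : LinearMap.range d1 = B.inv {a} ⊔ B.inv {b} ⊔ B.inv {c} := by
    simp only [d1, LinearMap.range_coprod, Submodule.range_subtype, sup_assoc]
  have hk2 : Module.finrank (ZMod 2) (LinearMap.ker d2) ≤ B.comp {a, b, c} := by
    rw [← finrank_inv]
    have key : ∀ x : LinearMap.ker d2, x.1.1.1 = x.1.2.1.1 ∧ x.1.1.1 = x.1.2.2.1 := by
      rintro ⟨x, hx⟩
      rw [LinearMap.mem_ker] at hx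
      have e1 : x.1.1 + x.2.2.1 = 0 := congrArg (fun y => y.1.1) hx
      have e2 : x.1.1 + x.2.1.1 = 0 := congrArg (fun y => y.2.1.1) hx
      exact ⟨funext fun v => CharTwo.add_eq_zero.1 (congrFun e2 v),
        funext fun v => CharTwo.add_eq_zero.1 (congrFun e1 v)⟩
    let T : LinearMap.ker d2 →ₗ[ZMod 2] B.inv {a, b, c} :=
      { toFun := fun x => ⟨x.1.1.1, by
          rintro v w ⟨d, hd, hvw⟩
          rcases hd with rfl | rfl | rfl
          · exact x.1.1.2 v w ⟨d, by simp, hvw⟩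
          · exact x.1.1.2 v w ⟨d, by simp, hvw⟩
          · rw [(key x).1]
            exact x.1.2.1.2 v w ⟨d, by simp, hvw⟩⟩
        map_add' := fun _ _ => rfl
        map_smul' := fun _ _ => rfl }
    refine LinearMap.finrank_le_finrank_of_injective (f := T) ?_
    intro x y h
    have h0 : (T x).1 = (T y).1 := by rw [h]
    have h' : x.1.1.1 = y.1.1.1 := h0
    refine Subtype.ext (Prod.ext (Subtype.ext h') (Prod.ext (Subtype.ext ?_) (Subtype.ext ?_)))
    · rw [← (key x).1, ← (key y).1, h']
    · rw [← (key x).2, ← (key y).2, h']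
  have n2 := LinearMap.finrank_range_add_finrank_ker d2
  have n1 := LinearMap.finrank_range_add_finrank_ker d1
  have n0 := Submodule.finrank_mono hle
  have nV := B.card_le_finrank_sup a b c
  have ha := B.two_mul_comp_singleton a
  have hb := B.two_mul_comp_singleton b
  have hc := B.two_mul_comp_singleton c
  rw [← hr1] at nV
  simp only [Module.finrank_prod, finrank_inv] at n1 n2
  unfold faces
  omega

end Bubble

namespace FeynmanGraph

variable {r : ℕ} {S : Type} {𝓑 : S → Bubble (Colour r)} {n : S →₀ ℕ} (G : FeynmanGraph 𝓑 n)

theorem comp_bubble_image_some (A : Set (Colour r)) :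
    G.bubble.comp (some '' A) = ∑ i : Vertices n, (𝓑 i.1).comp A := by
  have : ∀ i : Vertices n, Fintype (Quot fun v w : (𝓑 i.1).V => ∃ c ∈ A, (𝓑 i.1).edge c v = w) :=
    fun i => Fintype.ofFinite _
  simp only [Bubble.comp, Nat.card_eq_fintype_card (α := Quot fun v w : (𝓑 _).V => _)]
  rw [← Fintype.card_sigma, ← Nat.card_eq_fintype_card]
  refine Nat.card_congr
    { toFun := Quot.lift (fun x => ⟨x.1, Quot.mk _ x.2⟩) ?_
      invFun := fun y => Quot.lift (fun v => Quot.mk _ ⟨y.1, v⟩) ?_ y.2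
      left_inv := by rintro ⟨x⟩; rfl
      right_inv := by rintro ⟨i, ⟨x⟩⟩; rfl }
  · rintro x _ ⟨_, ⟨c, hc, rfl⟩, rfl⟩
    exact congrArg (Sigma.mk x.1) (Quot.sound ⟨c, hc, rfl⟩)
  · rintro v _ ⟨c, hc, rfl⟩
    exact Quot.sound ⟨some c, ⟨c, hc, rfl⟩, rfl⟩

theorem faces_bubble_some (a b : Colour r) :
    G.bubble.faces (some a) (some b) = ∑ i : Vertices n, (𝓑 i.1).faces a b := by
  unfold Bubble.faces
  rw [← comp_bubble_image_some, Set.image_pair]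

/-- The bipartite graph whose vertices are the components of the subgraph with colours `0`, `a`, `b`
and the interaction vertices, and whose edges are the faces of colours `a`, `b`, is connected when
the Feynman graph is; the inequality compares its numbers of vertices and of edges. -/
theorem comp_add_card_le (hG : G.Connected) (a b : Colour r) :
    G.bubble.comp {none, some a, some b} + Nat.card (Vertices n) ≤
      G.bubble.faces (some a) (some b) + 1 := by
  let R : G.bubble.V → G.bubble.V → Prop := fun v w =>
    ∃ c ∈ ({some a, some b} : Set (Option (Colour r))), G.bubble.edge c v = w
  let R' : G.bubble.V → G.bubble.V → Prop := fun v w =>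
    ∃ c ∈ ({none, some a, some b} : Set (Option (Colour r))), G.bubble.edge c v = w
  let s : Quot R → Quot R' ⊕ Vertices n :=
    Quot.lift (fun x => Sum.inl (Quot.mk _ x)) (by
      rintro x y ⟨c, hc, h⟩
      exact congrArg Sum.inl (Quot.sound ⟨c, Or.inr hc, h⟩))
  let t : Quot R → Quot R' ⊕ Vertices n :=
    Quot.lift (fun x => Sum.inr x.1) (by
      rintro x y ⟨c, rfl | rfl, rfl⟩ <;> rfl)
  have h1 := card_le_card_edges_add_card_quot s t
  rw [Nat.card_sum] at h1
  have h2 : Nat.card (Quot fun x y => ∃ e, s e = x ∧ t e = y) ≤ 1 := by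
    have hst : ∀ x : Fields 𝓑 n, Quot.mk (fun x y => ∃ e, s e = x ∧ t e = y)
        (Sum.inl (Quot.mk _ x)) = Quot.mk _ (Sum.inr x.1) :=
      fun x => Quot.sound ⟨Quot.mk _ x, rfl, rfl⟩
    let F : (Quot fun i j : Vertices n => ∃ x : Fields 𝓑 n, x.1 = i ∧ (G.wick x).1 = j) →
        Quot fun x y => ∃ e, s e = x ∧ t e = y :=
      Quot.lift (fun i => Quot.mk _ (Sum.inr i)) (by
        rintro _ _ ⟨x, rfl, rfl⟩
        rw [← hst, ← hst]
        exact congrArg (fun q => Quot.mk _ (Sum.inl q)) (Quot.sound ⟨none, by simp, rfl⟩))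
    have hF : Function.Surjective F := by
      rintro ⟨⟨⟨x⟩⟩ | i⟩
      · exact ⟨Quot.mk _ x.1, (hst x).symm⟩
      · exact ⟨Quot.mk _ i, rfl⟩
    have := Nat.card_le_card_of_surjective F hF
    unfold Connected at hG
    omega
  change Nat.card (Quot R') + _ ≤ Nat.card (Quot R) + 1
  omega

end FeynmanGraph

/-! ### Cyclic permutations -/

section CyclicPermutations

variable {C : Type} [Fintype C]

theorem isCycleOn_univ_iff_cycleType [DecidableEq C] (hC : 2 ≤ Fintype.card C)
    (σ : Equiv.Perm C) :
    σ.IsCycleOn Set.univ ↔ σ.cycleType = {Fintype.card C} := by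
  have hnt : (Set.univ : Set C).Nontrivial := by
    have := Fintype.one_lt_card_iff_nontrivial.1 hC
    exact Set.nontrivial_univ
  constructor
  · intro h
    have hcyc : σ.IsCycle :=
      Equiv.Perm.isCycle_iff_exists_isCycleOn.2 ⟨_, hnt, h, fun _ _ => Set.mem_univ _⟩
    have hsupp : σ.support = Finset.univ := Finset.eq_univ_of_forall fun x =>
      Equiv.Perm.mem_support.2 (h.apply_ne hnt (Set.mem_univ x))
    rw [hcyc.cycleType, hsupp, Finset.card_univ]
  · intro h
    have hcyc : σ.IsCycle := by rw [← Equiv.Perm.card_cycleType_eq_one, h, Multiset.card_singleton]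
    have hsupp : σ.support = Finset.univ := by
      rw [← Finset.card_eq_iff_eq_univ, ← Equiv.Perm.sum_cycleType, h, Multiset.sum_singleton]
    have := hcyc.isCycleOn
    convert this using 1
    refine (Set.eq_univ_of_forall fun x => ?_).symm
    have hx : x ∈ σ.support := hsupp ▸ Finset.mem_univ x
    exact Equiv.Perm.mem_support.1 hx

open Classical in
theorem card_isCycleOn_univ (hC : 2 ≤ Fintype.card C) :
    Fintype.card {σ : Equiv.Perm C // σ.IsCycleOn Set.univ} = (Fintype.card C - 1).factorial := by
  have h := Equiv.Perm.card_of_cycleType_singleton hC le_rfl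
  rw [Nat.choose_self, mul_one] at h
  rw [Fintype.card_subtype, ← h]
  congr 1
  ext σ
  simp only [Finset.mem_filter, Finset.mem_univ, true_and]
  exact isCycleOn_univ_iff_cycleType hC σ

open Classical in
/-- By conjugation with transpositions, the images of a fixed colour under the cyclic permutations
are equidistributed among the other colours. -/
theorem card_isCycleOn_univ_apply_eq (hC : 2 ≤ Fintype.card C) {a b : C} (hab : a ≠ b) :
    Finset.card {σ : {σ : Equiv.Perm C // σ.IsCycleOn Set.univ} | σ.1 a = b} =
      (Fintype.card C - 2).factorial := by
  have hnt : (Set.univ : Set C).Nontrivial := by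
    have := Fintype.one_lt_card_iff_nontrivial.1 hC
    exact Set.nontrivial_univ
  have hle : ∀ b b' : C, a ≠ b → a ≠ b' →
      Finset.card {σ : {σ : Equiv.Perm C // σ.IsCycleOn Set.univ} | σ.1 a = b} ≤
        Finset.card {σ : {σ : Equiv.Perm C // σ.IsCycleOn Set.univ} | σ.1 a = b'} := by
    intro b b' hb hb'
    let τ := Equiv.swap b b'
    have hτ : τ⁻¹ a = a := by
      rw [Equiv.swap_inv, Equiv.swap_apply_of_ne_of_ne hb hb']
    refine Finset.card_le_card_of_injOn
      (fun σ => ⟨τ * σ.1 * τ⁻¹, by simpa using σ.2.conj (g := τ)⟩) ?_ ?_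
    · intro σ hσ
      have hσ : σ.1 a = b := (Finset.mem_filter.1 hσ).2
      refine Finset.mem_coe.2 (Finset.mem_filter.2 ⟨Finset.mem_univ _, ?_⟩)
      change τ (σ.1 (τ⁻¹ a)) = b'
      rw [hτ, hσ]
      exact Equiv.swap_apply_left b b'
    · intro σ _ σ' _ h
      have h' : τ * σ.1 * τ⁻¹ = τ * σ'.1 * τ⁻¹ := congrArg Subtype.val h
      exact Subtype.ext (mul_left_cancel (mul_right_cancel h'))
  have htot : ∑ c ∈ Finset.univ.erase a,
      Finset.card {σ : {σ : Equiv.Perm C // σ.IsCycleOn Set.univ} | σ.1 a = c} =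
        (Fintype.card C - 1).factorial := by
    rw [← card_isCycleOn_univ hC, ← Finset.card_univ]
    refine (Finset.card_eq_sum_card_fiberwise fun σ _ => ?_).symm
    exact Finset.mem_coe.2 (Finset.mem_erase.2 ⟨σ.2.apply_ne hnt (Set.mem_univ a),
      Finset.mem_univ _⟩)
  rw [Finset.sum_congr rfl fun c hc => le_antisymm
      (hle c b (Finset.ne_of_mem_erase hc).symm hab) (hle b c hab (Finset.ne_of_mem_erase hc).symm),
    Finset.sum_const, Finset.card_erase_of_mem (Finset.mem_univ a), Finset.card_univ,
    smul_eq_mul] at htot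
  obtain ⟨m, hm⟩ := Nat.exists_eq_add_of_le hC
  rw [hm, show 2 + m - 1 = m + 1 by omega, Nat.factorial_succ] at htot
  rw [hm, Nat.add_sub_cancel_left]
  exact Nat.eq_of_mul_eq_mul_left (Nat.succ_pos m) htot

open Classical in
theorem sum_isCycleOn_univ (hC : 2 ≤ Fintype.card C) (φ : C → C → ℝ) :
    ∑ σ : {σ : Equiv.Perm C // σ.IsCycleOn Set.univ}, ∑ a, φ a (σ.1 a) =
      (Fintype.card C - 2).factorial * ∑ a, ∑ b ∈ Finset.univ.erase a, φ a b := by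
  have hnt : (Set.univ : Set C).Nontrivial := by
    have := Fintype.one_lt_card_iff_nontrivial.1 hC
    exact Set.nontrivial_univ
  rw [Finset.sum_comm, Finset.mul_sum]
  refine Finset.sum_congr rfl fun a _ => ?_
  rw [← Finset.sum_fiberwise_of_maps_to (g := fun σ => σ.1 a) (t := Finset.univ.erase a)
    (fun σ _ => Finset.mem_erase.2 ⟨σ.2.apply_ne hnt (Set.mem_univ a), Finset.mem_univ _⟩),
    Finset.mul_sum]
  refine Finset.sum_congr rfl fun b hb => ?_
  rw [← card_isCycleOn_univ_apply_eq hC (Finset.ne_of_mem_erase hb).symm, ← nsmul_eq_mul,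
    ← Finset.sum_const]
  refine Finset.sum_congr rfl fun σ hσ => ?_
  rw [(Finset.mem_filter.1 hσ).2]

end CyclicPermutations

/-! ### Jackets and the degree -/

namespace Bubble

theorem faces_comm {C : Type} (B : Bubble C) (a b : C) : B.faces a b = B.faces b a := by
  unfold faces
  rw [Set.pair_comm]

theorem comp_restrict {C C' : Type} (B : Bubble C) (f : C' → C) (A : Set C') :
    (B.restrict f).comp A = B.comp (f '' A) := by
  have h : ∀ v w : B.V, (∃ c ∈ f '' A, B.edge c v = w) ↔ ∃ c ∈ A, B.edge (f c) v = w := by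
    simp
  simp only [comp, h]
  rfl

theorem faces_restrict {C C' : Type} (B : Bubble C) (f : C' → C) (a b : C') :
    (B.restrict f).faces a b = B.faces (f a) (f b) := by
  unfold faces
  rw [comp_restrict, Set.image_pair]

variable {C : Type} [Fintype C] (B : Bubble C)

theorem two_mul_numEdges_jacket (σ : Equiv.Perm C) (hσ : σ.IsCycleOn Set.univ)
    (filled : B.V → Bool) :
    2 * (B.jacket σ hσ filled).numEdges = Nat.card B.V * Fintype.card C := by
  rw [← Nat.card_eq_fintype_card, ← Nat.card_prod]
  have : Finite (B.jacket σ hσ filled).H := inferInstanceAs (Finite (B.V × C))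
  exact two_mul_card_quot_involution (B.jacket σ hσ filled).opp (B.jacket σ hσ filled).opp_opp
    (B.jacket σ hσ filled).opp_ne

theorem numComponents_jacket (σ : Equiv.Perm C) (hσ : σ.IsCycleOn Set.univ)
    (filled : B.V → Bool) : (B.jacket σ hσ filled).numComponents = B.numComponents := by
  have h : (fun v w : B.V => ∃ x : B.V × C, x.1 = v ∧ B.edge x.2 x.1 = w) =
      fun v w => ∃ c ∈ Set.univ, B.edge c v = w := by
    ext v w
    constructor
    · rintro ⟨x, rfl, h⟩
      exact ⟨x.2, Set.mem_univ _, h⟩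
    · rintro ⟨c, -, h⟩
      exact ⟨(v, c), rfl, h⟩
  change Nat.card (Quot fun v w : B.V => ∃ x : B.V × C, x.1 = v ∧ B.edge x.2 x.1 = w) = _
  rw [h]
  rfl

/-- The faces of a jacket are the faces of the bubble whose colours are adjacent in the cycle. -/
theorem numFaces_jacket (σ : Equiv.Perm C) (hσ : σ.IsCycleOn Set.univ) :
    (B.jacket σ hσ fun _ => false).numFaces = ∑ a, B.faces a (σ a) := by
  have : ∀ a, Fintype (Quot fun v w : B.V => ∃ c ∈ ({a, σ a} : Set C), B.edge c v = w) :=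
    fun a => Fintype.ofFinite _
  simp only [faces, comp, Nat.card_eq_fintype_card (α := Quot fun v w : B.V => _)]
  rw [← Fintype.card_sigma, ← Nat.card_eq_fintype_card]
  set J := B.jacket σ hσ fun _ => false with hJ
  have hE : ∀ v c s, Quot.mk J.sideRel ((v, c), s) = Quot.mk J.sideRel ((B.edge c v, c), s) := by
    intro v c s
    refine Quot.sound (Or.inl ?_)
    change ((B.edge c v, c), s) = ((B.edge c v, c), -(s * if false = false then -1 else 1))
    simp
  have hR : ∀ v c, Quot.mk J.sideRel ((v, c), 1) = Quot.mk J.sideRel ((v, σ c), -1) :=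
    fun v c => Quot.sound (Or.inr ⟨rfl, rfl⟩)
  -- `(v, c, 1)` lies on the face of colours `c`, `σ c`, and `(v, c, -1)` on that of `σ⁻¹ c`, `c`
  let col : C × ℤˣ → C := fun p => if p.2 = 1 then p.1 else σ⁻¹ p.1
  let cls : (a : C) → B.V → Σ a, Quot fun v w : B.V => ∃ c ∈ ({a, σ a} : Set C), B.edge c v = w :=
    fun a v => ⟨a, Quot.mk _ v⟩
  have hcls : ∀ a v c, c = a ∨ c = σ a → cls a v = cls a (B.edge c v) := fun a v c h =>
    congrArg (Sigma.mk a) (Quot.sound ⟨c, h, rfl⟩)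
  refine Nat.card_congr
    { toFun := Quot.lift (fun p => cls (col (p.1.2, p.2)) p.1.1) ?_
      invFun := fun y => Quot.lift (fun v => Quot.mk J.sideRel ((v, y.1), 1)) ?_ y.2
      left_inv := ?_
      right_inv := ?_ }
  · rintro ⟨⟨v, c⟩, s⟩ q (rfl | ⟨h, rfl⟩)
    · have hs : (J.opp (v, c), -(s * J.sign (v, c))) = ((B.edge c v, c), s) := by
        change ((B.edge c v, c), -(s * if false = false then -1 else 1)) = ((B.edge c v, c), s)
        simp
      change cls _ _ = (fun p : J.H × ℤˣ => cls (col (p.1.2, p.2)) p.1.1)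
        (J.opp (v, c), -(s * J.sign (v, c)))
      rw [hs]
      refine hcls _ _ _ ?_
      rcases Int.units_eq_one_or s with rfl | rfl <;> simp [col]
    · have h : s = 1 := h
      subst h
      change cls (col (c, 1)) v = cls (col (σ c, -1)) v
      simp [col]
  · rintro v _ ⟨c, hc | hc, rfl⟩
    · subst hc
      exact hE _ _ _
    · have hc : c = σ y.1 := hc
      rw [hR, hR, hc]
      exact hE _ _ _
  · rintro ⟨⟨⟨v, c⟩, s⟩⟩
    rcases Int.units_eq_one_or s with rfl | rfl
    · change Quot.mk J.sideRel ((v, col (c, 1)), 1) = Quot.mk J.sideRel ((v, c), 1)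
      simp [col]
    · change Quot.mk J.sideRel ((v, col (c, -1)), 1) = Quot.mk J.sideRel ((v, c), -1)
      rw [hR]
      simp [col]
  · rintro ⟨a, ⟨v⟩⟩
    change cls (col (a, 1)) v = cls a v
    simp [col]

open Classical in
/-- The sum of the numbers of faces over all ordered pairs of distinct colours. -/
noncomputable def facesSum : ℝ := ∑ a, ∑ b ∈ Finset.univ.erase a, (B.faces a b : ℝ)

theorem genus_jacket_eq (σ : Equiv.Perm C) (hσ : σ.IsCycleOn Set.univ) :
    (B.jacket σ hσ fun _ => false).genus =
      B.numComponents + ((Fintype.card C : ℝ) - 2) / 4 * Nat.card B.V -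
        1 / 2 * ∑ a, (B.faces a (σ a) : ℝ) := by
  have hE : 2 * ((B.jacket σ hσ fun _ => false).numEdges : ℝ) =
      Nat.card B.V * Fintype.card C := by
    exact_mod_cast B.two_mul_numEdges_jacket σ hσ _
  have hV : (B.jacket σ hσ fun _ => false).numVertices = Nat.card B.V := rfl
  unfold EmbeddedGraph.genus
  rw [numComponents_jacket, numFaces_jacket, hV]
  push_cast
  linear_combination (1 / 4) * hE

/-- The degree in terms of numbers of bicoloured faces: every ordered pair of distinct colours is
adjacent in `(d - 2)!` of the `(d - 1)!` cyclic permutations of the `d` colours. -/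
theorem deg_eq (hC : 2 ≤ Fintype.card C) :
    B.deg = ((Fintype.card C - 1).factorial : ℝ) / 2 *
        (B.numComponents + ((Fintype.card C : ℝ) - 2) / 4 * Nat.card B.V) -
      ((Fintype.card C - 2).factorial : ℝ) / 4 * B.facesSum := by
  classical
  unfold deg facesSum
  simp only [genus_jacket_eq]
  rw [Finset.sum_sub_distrib, ← Finset.mul_sum, Finset.sum_const, Finset.card_univ,
    card_isCycleOn_univ hC, sum_isCycleOn_univ hC fun a b => (B.faces a b : ℝ), nsmul_eq_mul]
  ring

theorem facesSum_eq [DecidableEq C] :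
    B.facesSum = ∑ a, ∑ b ∈ Finset.univ.erase a, (B.faces a b : ℝ) := by
  unfold facesSum
  congr!

theorem facesSum_option (B : Bubble (Option C)) :
    B.facesSum = 2 * ∑ c, (B.faces none (some c) : ℝ) + (B.restrict some).facesSum := by
  classical
  have h : ∀ a : C, ∑ b ∈ Finset.univ.erase (some a), (B.faces (some a) b : ℝ) =
      B.faces none (some a) +
        ∑ b ∈ Finset.univ.erase a, ((B.restrict some).faces a b : ℝ) := by
    intro a
    have e : (Finset.univ.erase (some a) : Finset (Option C)) =
        insert none ((Finset.univ.erase a).map Function.Embedding.some) := by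
      ext (_ | x) <;> simp
    rw [e, Finset.sum_insert (by simp), Finset.sum_map, faces_comm]
    congr 1
    refine Finset.sum_congr rfl fun b _ => ?_
    rw [faces_restrict]
    rfl
  have e0 : (Finset.univ.erase none : Finset (Option C)) =
      Finset.univ.map Function.Embedding.some := by
    ext (_ | x) <;> simp
  rw [facesSum_eq, facesSum_eq, Fintype.sum_option, Finset.sum_congr rfl fun a _ => h a,
    Finset.sum_add_distrib, e0, Finset.sum_map]
  simp only [Function.Embedding.some_apply]
  ring

end Bubble

/-! ### The parameters of a Feynman graph -/

/-- Both orders of a pair contribute equally, so the sum over ordered pairs is even. -/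
theorem exists_sum_sum_erase_eq_two_mul {C : Type} [Fintype C] [DecidableEq C] (φ : C → C → ℕ)
    (hφ : ∀ a b, φ a b = φ b a) : ∃ m, ∑ a, ∑ b ∈ Finset.univ.erase a, φ a b = 2 * m := by
  change 2 ∣ ∑ a, ∑ b ∈ Finset.univ.erase a, φ a b
  rw [← ZMod.natCast_eq_zero_iff, Finset.sum_sigma', Nat.cast_sum]
  refine Finset.sum_involution (fun x _ => ⟨x.2, x.1⟩) ?_ ?_ ?_ ?_
  · rintro ⟨a, b⟩ _
    rw [hφ]
    exact CharTwo.add_self_eq_zero _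
  · rintro ⟨a, b⟩ h _ h'
    simp only [Finset.mem_sigma, Finset.mem_univ, Finset.mem_erase, true_and, and_true] at h
    exact h (Sigma.mk.inj h').1
  · rintro ⟨a, b⟩ h
    simpa [eq_comm] using h
  · rintro ⟨a, b⟩ _
    rfl

variable {r : ℕ}

theorem card_colour : Fintype.card (Colour r) = r + 2 := by
  simp [add_comm]

theorem Bubble.dExp_eq (B : Bubble (Colour r)) :
    B.dExp = r + B.traces + r / 4 * Nat.card B.V - B.facesSum / (2 * (r + 1)) := by
  have hf : ((r + 1).factorial : ℝ) = (r + 1) * r.factorial := by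
    rw [Nat.factorial_succ]; push_cast; ring
  have h0 : (r.factorial : ℝ) ≠ 0 := by exact_mod_cast r.factorial_ne_zero
  have h1 : (r : ℝ) + 1 ≠ 0 := by positivity
  unfold dExp
  rw [B.deg_eq (by rw [card_colour]; omega), card_colour]
  simp only [Nat.add_sub_cancel, show r + 2 - 1 = r + 1 by omega]
  push_cast
  rw [hf]
  field_simp
  ring

namespace FeynmanGraph

variable {S : Type} {𝓑 : S → Bubble (Colour r)} {n : S →₀ ℕ} (G : FeynmanGraph 𝓑 n)

theorem two_mul_p : 2 * G.p = Nat.card (Fields 𝓑 n) :=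
  two_mul_card_quot_involution G.wick G.wick_wick G.wick_ne

theorem card_fields : Nat.card (Fields 𝓑 n) = ∑ i : Vertices n, Nat.card (𝓑 i.1).V := by
  simp only [Nat.card_eq_fintype_card]
  rw [← Fintype.card_sigma]

theorem facesSum_restrict_bubble :
    (G.bubble.restrict some).facesSum = ∑ i : Vertices n, (𝓑 i.1).facesSum := by
  classical
  simp only [Bubble.facesSum_eq, Bubble.faces_restrict, faces_bubble_some, Nat.cast_sum]
  exact (Finset.sum_congr rfl fun a _ => Finset.sum_comm).trans Finset.sum_comm

theorem numComponents_restrict_bubble :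
    (G.bubble.restrict some).numComponents = ∑ i : Vertices n, (𝓑 i.1).numComponents := by
  unfold Bubble.numComponents
  rw [← comp_bubble_image_some, Bubble.comp_restrict]

theorem sum_faces_none :
    ∑ c, (G.bubble.faces none (some c) : ℝ) = G.f + G.phi := by
  unfold f phi
  rw [Fintype.sum_sum_type]
  push_cast
  rfl

/-- The parameter of the large `D` expansion in terms of numbers of faces only. -/
theorem ell_eq :
    G.ell = ((r : ℝ) + 1) * (r + 2) * (1 - Nat.card (Vertices n) + G.p / 2) +
      (G.bubble.restrict some).facesSum / 2 -
      (r + 1) * ∑ c, (G.bubble.faces none (some c) : ℝ) := by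
  have h1 : (r : ℝ) + 1 ≠ 0 := by positivity
  have hV : 2 * (G.p : ℝ) = ∑ i : Vertices n, (Nat.card (𝓑 i.1).V : ℝ) := by
    exact_mod_cast G.two_mul_p.trans card_fields
  have hD : ∑ i : Vertices n, (𝓑 i.1).dExp = r * Nat.card (Vertices n) +
      ∑ i : Vertices n, ((𝓑 i.1).traces : ℝ) + r / 4 * (2 * G.p) -
        (G.bubble.restrict some).facesSum / (2 * (r + 1)) := by
    simp only [Bubble.dExp_eq]
    rw [hV, facesSum_restrict_bubble, Finset.sum_sub_distrib, Finset.sum_add_distrib,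
      Finset.sum_add_distrib, Finset.sum_const, Finset.card_univ, Finset.mul_sum,
      Finset.sum_div, nsmul_eq_mul, Nat.card_eq_fintype_card]
    ring
  have hh : (G.h : ℝ) = 2 + G.p - (2 * Nat.card (Vertices n) -
      ∑ i : Vertices n, ((𝓑 i.1).traces : ℝ)) - G.f := by
    unfold h
    rw [Finset.sum_sub_distrib, Finset.sum_const, Finset.card_univ, Nat.card_eq_fintype_card]
    push_cast
    simp
    ring
  unfold ell
  rw [hD, hh, sum_faces_none]
  field_simp
  ring

theorem ell_eq_ind0 (hr : 1 ≤ r) :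
    G.ell = 2 * G.bubble.ind0 + ((r : ℝ) + 1) * (r + 2) *
      (1 + ∑ i : Vertices n, (((𝓑 i.1).numComponents : ℝ) - 1) - G.bubble.numComponents) := by
  have hf1 : ((r + 1).factorial : ℝ) = (r + 1) * r.factorial := by
    rw [Nat.factorial_succ]; push_cast; ring
  have hf2 : ((r + 2).factorial : ℝ) = (r + 2) * ((r + 1) * r.factorial) := by
    rw [Nat.factorial_succ, ← hf1]; push_cast; ring
  have h0 : (r.factorial : ℝ) ≠ 0 := by exact_mod_cast r.factorial_ne_zero
  have hV : (Nat.card G.bubble.V : ℝ) = 2 * G.p := by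
    have h := G.two_mul_p
    change _ = Nat.card G.bubble.V at h
    rw [← h]
    push_cast
    rfl
  have hV' : (Nat.card (G.bubble.restrict some).V : ℝ) = 2 * G.p := hV
  have hc : ((G.bubble.restrict some).numComponents : ℝ) =
      ∑ i : Vertices n, ((𝓑 i.1).numComponents : ℝ) := by
    exact_mod_cast G.numComponents_restrict_bubble
  have hO : Fintype.card (Option (Colour r)) = r + 3 := by
    rw [Fintype.card_option, card_colour]
  unfold Bubble.ind0
  rw [Bubble.deg_eq _ (by rw [hO]; omega), Bubble.deg_eq _ (by rw [card_colour]; omega), hO,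
    card_colour, hV, hV', hc, ell_eq, Bubble.facesSum_option, Finset.sum_sub_distrib,
    Finset.sum_const, Finset.card_univ, ← Nat.card_eq_fintype_card, nsmul_eq_mul]
  simp only [Nat.add_sub_cancel, show r + 3 - 1 = r + 2 by omega, show r + 3 - 2 = r + 1 by omega,
    show r + 2 - 1 = r + 1 by omega]
  push_cast
  rw [hf1, hf2]
  field_simp
  ring

/-- Euler's inequality for the subgraph with colours `0`, `a` and `b`, combined with the
connectedness of the Feynman graph. -/
theorem faces_none_add_le (hG : G.Connected) (a b : Colour r) :
    G.bubble.faces none (some a) + G.bubble.faces none (some b) + 2 * Nat.card (Vertices n) ≤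
      G.bubble.faces (some a) (some b) + 2 + G.p := by
  have h1 := G.bubble.euler_le none (some a) (some b)
  have h2 := G.comp_add_card_le hG a b
  have h3 : 2 * G.p = Nat.card G.bubble.V := G.two_mul_p
  omega

theorem h_nonneg (hG : G.Connected) : 0 ≤ G.h := by
  have h1 := G.faces_none_add_le hG (Sum.inl 0) (Sum.inl 1)
  have h2 : G.f = G.bubble.faces none (some (Sum.inl 0)) + G.bubble.faces none (some (Sum.inl 1)) :=
    Fin.sum_univ_two _
  have h3 : G.bubble.faces (some (Sum.inl 0)) (some (Sum.inl 1)) =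
      ∑ i : Vertices n, (𝓑 i.1).traces := G.faces_bubble_some _ _
  unfold h
  rw [Finset.sum_sub_distrib, Finset.sum_const, Finset.card_univ, ← Nat.card_eq_fintype_card,
    nsmul_eq_mul, ← Nat.cast_sum]
  omega

/-- The parameter of the large `D` expansion is a sum over the unordered pairs of tensor or matrix
colours of the slacks in `faces_none_add_le`. -/
theorem exists_ell_eq_natCast (hG : G.Connected) : ∃ l : ℕ, G.ell = l := by
  classical
  -- the truncated subtraction is exact, by `faces_none_add_le`
  let φ : Colour r → Colour r → ℕ := fun a b =>
    G.bubble.faces (some a) (some b) + 2 + G.p -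
      (G.bubble.faces none (some a) + G.bubble.faces none (some b) + 2 * Nat.card (Vertices n))
  have hφ : ∀ a b, (φ a b : ℝ) = (G.bubble.restrict some).faces a b + 2 + G.p -
      (G.bubble.faces none (some a) + G.bubble.faces none (some b) +
        2 * Nat.card (Vertices n)) := by
    intro a b
    rw [Bubble.faces_restrict]
    simp only [φ]
    rw [Nat.cast_sub (G.faces_none_add_le hG a b)]
    push_cast
    ring
  obtain ⟨m, hm⟩ := exists_sum_sum_erase_eq_two_mul φ (by
    intro a b
    simp only [φ]
    rw [Bubble.faces_comm _ (some a), add_comm (G.bubble.faces none (some a))])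
  refine ⟨m, ?_⟩
  have hm' : ∑ a, ∑ b ∈ Finset.univ.erase a, (φ a b : ℝ) = 2 * m := by exact_mod_cast hm
  simp only [hφ, Finset.sum_sub_distrib, Finset.sum_add_distrib, Finset.sum_const, Finset.card_univ,
    card_colour, nsmul_eq_mul,
    Finset.sum_erase_eq_sub (Finset.mem_univ _), ← Finset.mul_sum] at hm'
  rw [ell_eq, Bubble.facesSum_eq]
  simp only [Finset.sum_erase_eq_sub (Finset.mem_univ _), Finset.sum_sub_distrib]
  push_cast at hm'
  linear_combination (1 / 2) * hm'

/-- An index value is free for each closed strand, that is, each face of colours `0` and `c`. -/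
theorem card_indexAssignment (N D : ℕ) :
    Nat.card (G.IndexAssignment N D) = N ^ G.f * D ^ G.phi := by
  let Q : Colour r → Type := fun c =>
    Quot fun v w : G.bubble.V => ∃ e ∈ ({none, some c} : Set (Option (Colour r))),
      G.bubble.edge e v = w
  have : ∀ c, Fintype (Q c) := fun c => Fintype.ofFinite _
  have e : G.IndexAssignment N D ≃ ((c : Colour r) → Q c → Fin (dim N D c)) :=
    { toFun := fun x c => Quot.lift (x.1 c) (by
        rintro v _ ⟨e, rfl | rfl, rfl⟩
        · exact (x.2.2 c v).symm
        · exact (x.2.1 c v.1 v.2).symm)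
      invFun := fun y => ⟨fun c v => y c (Quot.mk _ v),
        fun c i v => congrArg (y c) (Quot.sound ⟨some c, by simp, rfl⟩).symm,
        fun c v => congrArg (y c) (Quot.sound ⟨none, by simp, rfl⟩).symm⟩
      left_inv := fun x => rfl
      right_inv := fun y => by ext c ⟨v⟩; rfl }
  have hQ : ∀ c, Fintype.card (Q c) = G.bubble.faces none (some c) := fun c =>
    Nat.card_eq_fintype_card.symm
  classical
  rw [Nat.card_congr e, Nat.card_eq_fintype_card, Fintype.card_pi]
  simp only [Fintype.card_fun, Fintype.card_fin, hQ]
  rw [Fintype.prod_sum_type]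
  unfold f phi
  simp only [dim, Sum.elim_inl, Sum.elim_inr, Finset.prod_pow_eq_pow_sum]

theorem amplitude_eq {N D : ℕ} (hN : 1 ≤ N) (hD : 1 ≤ D) :
    G.amplitude N D =
      (N : ℝ) ^ (2 - (G.h : ℝ)) * (D : ℝ) ^ ((r : ℝ) + G.h - G.ell / (r + 1)) := by
  have hN' : (0 : ℝ) < N := by exact_mod_cast hN
  have hD' : (0 : ℝ) < D := by exact_mod_cast hD
  have h1 : (r : ℝ) + 1 ≠ 0 := by positivity
  have e1 : (1 / ((N : ℝ) * (D : ℝ) ^ r)) ^ G.p =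
      (N : ℝ) ^ (-(G.p : ℝ)) * (D : ℝ) ^ (-((r : ℝ) * G.p)) := by
    rw [Real.rpow_neg hN'.le, Real.rpow_neg hD'.le, Real.rpow_natCast, ← Nat.cast_mul,
      Real.rpow_natCast, one_div, inv_pow, mul_pow, mul_inv, pow_mul]
  have e2 : ∏ i : Vertices n, (𝓑 i.1).enhancedScaling N D =
      (N : ℝ) ^ (∑ i : Vertices n, (2 - ((𝓑 i.1).traces : ℝ))) *
        (D : ℝ) ^ (∑ i : Vertices n, (𝓑 i.1).dExp) := by
    simp only [Bubble.enhancedScaling]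
    rw [Finset.prod_mul_distrib, Real.rpow_sum_of_pos hN', Real.rpow_sum_of_pos hD']
  have e3 : (Nat.card (G.IndexAssignment N D) : ℝ) =
      (N : ℝ) ^ (G.f : ℝ) * (D : ℝ) ^ (G.phi : ℝ) := by
    rw [card_indexAssignment, Real.rpow_natCast, Real.rpow_natCast]
    push_cast
    rfl
  have hh : (2 : ℝ) - G.h =
      -(G.p : ℝ) + ∑ i : Vertices n, (2 - ((𝓑 i.1).traces : ℝ)) + G.f := by
    unfold h
    push_cast
    ring
  have hl : (r : ℝ) + G.h - G.ell / (r + 1) =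
      -((r : ℝ) * G.p) + ∑ i : Vertices n, (𝓑 i.1).dExp + G.phi := by
    unfold ell
    rw [mul_div_cancel_left₀ _ h1]
    ring
  unfold amplitude
  rw [e1, e2, e3, hh, hl, Real.rpow_add hN', Real.rpow_add hN', Real.rpow_add hD',
    Real.rpow_add hD']
  ring

end FeynmanGraph

/-! ### Large `N` and large `D` expansions -/

/-- In a finite expansion in decreasing powers, the first term is the limit. -/
theorem tendsto_sum_Ico_rpow_mul (a : ℕ → ℝ) {s : ℝ} (hs : 0 < s) {h M : ℕ} (hM : h < M) :
    Tendsto (fun N : ℕ => ∑ j ∈ Finset.Ico h M, (N : ℝ) ^ (-(s * ((j : ℝ) - h))) * a j) atTop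
      (𝓝 (a h)) := by
  have key : ∀ j ∈ Finset.Ico h M,
      Tendsto (fun N : ℕ => (N : ℝ) ^ (-(s * ((j : ℝ) - h))) * a j) atTop
        (𝓝 (if j = h then a j else 0)) := by
    intro j hj
    split_ifs with hjh
    · simp [hjh]
    · have hlt : (h : ℝ) < j := by
        exact_mod_cast lt_of_le_of_ne (Finset.mem_Ico.1 hj).1 (Ne.symm hjh)
      have h1 := ((tendsto_rpow_neg_atTop (mul_pos hs (sub_pos.2 hlt))).comp
        tendsto_natCast_atTop_atTop).mul_const (a j)
      rwa [zero_mul] at h1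
  have h2 := tendsto_finsetSum _ key
  rwa [Finset.sum_ite_eq' (Finset.Ico h M) h a, if_pos (Finset.mem_Ico.2 ⟨le_rfl, hM⟩)] at h2

section Expansions

variable {S : Type} (𝓑 : S → Bubble (Colour r)) (n : S →₀ ℕ)

theorem weight_ne_zero : weight n ≠ 0 := by
  unfold weight
  refine neg_ne_zero.2 (div_ne_zero (pow_ne_zero _ (by norm_num)) ?_)
  exact Finset.prod_ne_zero_iff.2 fun a _ => Nat.cast_ne_zero.2 (n a).factorial_ne_zero

/-- `M` exceeds the values of both expansion parameters on all connected Feynman graphs. -/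
def IsBound (M : ℕ) : Prop :=
  ∀ G : FeynmanGraph 𝓑 n, G.Connected →
    ∃ h ∈ Finset.range M, ∃ l ∈ Finset.range M, G.h = (h : ℤ) ∧ G.ell = (l : ℝ)

theorem exists_isBound (m : ℕ) : ∃ M, m < M ∧ IsBound 𝓑 n M := by
  classical
  refine ⟨m + 1 + ∑ G : FeynmanGraph 𝓑 n, (G.h.toNat + ⌊G.ell⌋₊), by omega, ?_⟩
  intro G hG
  have hle : G.h.toNat + ⌊G.ell⌋₊ ≤ ∑ G : FeynmanGraph 𝓑 n, (G.h.toNat + ⌊G.ell⌋₊) :=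
    Finset.single_le_sum (f := fun G : FeynmanGraph 𝓑 n => G.h.toNat + ⌊G.ell⌋₊)
      (fun _ _ => Nat.zero_le _) (Finset.mem_univ G)
  obtain ⟨l, hl⟩ := G.exists_ell_eq_natCast hG
  rw [hl, Nat.floor_natCast] at hle
  have hh := Int.toNat_of_nonneg (G.h_nonneg hG)
  exact ⟨G.h.toNat, Finset.mem_range.2 (by omega), l, Finset.mem_range.2 (by omega), hh.symm, hl⟩

variable {𝓑 n}

theorem freeEnergyH_eq_zero {M : ℕ} (hM : IsBound 𝓑 n M) {h : ℕ} (hh : M ≤ h) (D : ℕ) :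
    freeEnergyH 𝓑 n h D = 0 := by
  classical
  unfold freeEnergyH
  rw [Finset.sum_eq_zero, mul_zero]
  intro G hG
  obtain ⟨hc, e⟩ := (Finset.mem_filter.1 hG).2
  obtain ⟨h', h1, l', -, e', -⟩ := hM G hc
  have := Finset.mem_range.1 h1
  omega

theorem freeEnergyHL_eq_zero {M : ℕ} (hM : IsBound 𝓑 n M) {h l : ℕ} (hh : M ≤ h ∨ M ≤ l) :
    freeEnergyHL 𝓑 n h l = 0 := by
  have : IsEmpty {G : FeynmanGraph 𝓑 n // G.Connected ∧ G.h = h ∧ G.ell = l} := by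
    refine ⟨fun ⟨G, hc, e1, e2⟩ => ?_⟩
    obtain ⟨h', h1, l', h2, e3, e4⟩ := hM G hc
    have h1 := Finset.mem_range.1 h1
    have h2 := Finset.mem_range.1 h2
    have : l = l' := by exact_mod_cast e2.symm.trans e4
    omega
  unfold freeEnergyHL
  simp

open Classical in
theorem freeEnergyH_eq {h D : ℕ} (hD : 1 ≤ D) :
    freeEnergyH 𝓑 n h D = weight n * ∑ G : FeynmanGraph 𝓑 n with G.Connected ∧ G.h = (h : ℤ),
      (D : ℝ) ^ ((r : ℝ) + h - G.ell / (r + 1)) := by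
  unfold freeEnergyH
  congr 1
  refine Finset.sum_congr rfl fun G hG => ?_
  rw [G.amplitude_eq le_rfl hD, (Finset.mem_filter.1 hG).2.2]
  simp

theorem freeEnergy_eq_sum_range {M : ℕ} (hM : IsBound 𝓑 n M) {N D : ℕ} (hN : 1 ≤ N) (hD : 1 ≤ D) :
    freeEnergy 𝓑 n N D =
      ∑ h ∈ Finset.range M, (N : ℝ) ^ (2 - (h : ℝ)) * freeEnergyH 𝓑 n h D := by
  classical
  unfold freeEnergy
  rw [← Finset.sum_fiberwise_of_maps_to (g := fun G => G.h.toNat) (t := Finset.range M),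
    Finset.mul_sum]
  · refine Finset.sum_congr rfl fun h _ => ?_
    rw [freeEnergyH_eq hD, Finset.filter_filter, mul_left_comm]
    congr 1
    have hfil : ∀ G : FeynmanGraph 𝓑 n,
        (G.Connected ∧ G.h.toNat = h) ↔ (G.Connected ∧ G.h = (h : ℤ)) := fun G =>
      and_congr_right fun hG => by have := G.h_nonneg hG; omega
    rw [Finset.filter_congr fun G _ => hfil G, Finset.mul_sum]
    refine Finset.sum_congr (by congr!) fun G hG => ?_
    rw [G.amplitude_eq hN hD, (Finset.mem_filter.1 hG).2.2]
    simp
  · intro G hG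
    obtain ⟨h', h1, l', -, e', -⟩ := hM G (Finset.mem_filter.1 hG).2
    rwa [e', Int.toNat_natCast]

theorem freeEnergyH_eq_sum_range {M : ℕ} (hM : IsBound 𝓑 n M) (h : ℕ) {D : ℕ} (hD : 1 ≤ D) :
    freeEnergyH 𝓑 n h D =
      ∑ l ∈ Finset.range M, (D : ℝ) ^ ((r : ℝ) + h - l / (r + 1)) * freeEnergyHL 𝓑 n h l := by
  classical
  rw [freeEnergyH_eq hD,
    ← Finset.sum_fiberwise_of_maps_to (g := fun G => ⌊G.ell⌋₊) (t := Finset.range M),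
    Finset.mul_sum]
  · refine Finset.sum_congr rfl fun l _ => ?_
    unfold freeEnergyHL
    rw [Finset.filter_filter, mul_left_comm]
    congr 1
    have hfil : ∀ G : FeynmanGraph 𝓑 n,
        ((G.Connected ∧ G.h = (h : ℤ)) ∧ ⌊G.ell⌋₊ = l) ↔
          (G.Connected ∧ G.h = (h : ℤ) ∧ G.ell = l) := by
      intro G
      rw [and_assoc]
      refine and_congr_right fun hG => and_congr_right fun _ => ?_
      obtain ⟨l', hl'⟩ := G.exists_ell_eq_natCast hG
      rw [hl', Nat.floor_natCast, Nat.cast_inj]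
    rw [Finset.filter_congr fun G _ => hfil G, Nat.card_eq_fintype_card, Fintype.card_subtype,
      mul_comm, ← nsmul_eq_mul, ← Finset.sum_const]
    refine Finset.sum_congr rfl fun G hG => ?_
    rw [(Finset.mem_filter.1 hG).2.2.2]
  · intro G hG
    obtain ⟨h', -, l', h1, -, e'⟩ := hM G (Finset.mem_filter.1 hG).2.1
    rwa [e', Nat.floor_natCast]

variable (𝓑 n)

theorem finite_setOf_freeEnergyHL_ne_zero :
    {q : ℕ × ℕ | freeEnergyHL 𝓑 n q.1 q.2 ≠ 0}.Finite := by
  obtain ⟨M, -, hM⟩ := exists_isBound 𝓑 n 0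
  refine ((Set.finite_Iio M).prod (Set.finite_Iio M)).subset ?_
  rintro ⟨h, l⟩ hne
  exact ⟨not_le.1 fun hle => hne (freeEnergyHL_eq_zero hM (Or.inl hle)),
    not_le.1 fun hle => hne (freeEnergyHL_eq_zero hM (Or.inr hle))⟩

theorem freeEnergy_eq_finsum {N D : ℕ} (hN : 1 ≤ N) (hD : 1 ≤ D) :
    freeEnergy 𝓑 n N D = ∑ᶠ h : ℕ, (N : ℝ) ^ (2 - (h : ℝ)) * freeEnergyH 𝓑 n h D := by
  obtain ⟨M, -, hM⟩ := exists_isBound 𝓑 n 0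
  rw [freeEnergy_eq_sum_range hM hN hD, finsum_eq_sum_of_support_subset]
  intro h hne
  rw [Finset.coe_range, Set.mem_Iio]
  exact not_le.1 fun hle => hne (mul_eq_zero_of_right _ (freeEnergyH_eq_zero hM hle D))

theorem freeEnergyH_eq_finsum (h : ℕ) {D : ℕ} (hD : 1 ≤ D) :
    freeEnergyH 𝓑 n h D =
      ∑ᶠ l : ℕ, (D : ℝ) ^ ((r : ℝ) + h - l / (r + 1)) * freeEnergyHL 𝓑 n h l := by
  obtain ⟨M, -, hM⟩ := exists_isBound 𝓑 n 0
  rw [freeEnergyH_eq_sum_range hM h hD, finsum_eq_sum_of_support_subset]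
  intro l hne
  rw [Finset.coe_range, Set.mem_Iio]
  exact not_le.1 fun hle =>
    hne (mul_eq_zero_of_right _ (freeEnergyHL_eq_zero hM (Or.inr hle)))

theorem tendsto_freeEnergy (h : ℕ) {D : ℕ} (hD : 1 ≤ D) :
    Tendsto (fun N : ℕ => (N : ℝ) ^ ((h : ℝ) - 2) *
        (freeEnergy 𝓑 n N D -
          ∑ j ∈ Finset.range h, (N : ℝ) ^ (2 - (j : ℝ)) * freeEnergyH 𝓑 n j D))
      atTop (𝓝 (freeEnergyH 𝓑 n h D)) := by
  obtain ⟨M, hhM, hM⟩ := exists_isBound 𝓑 n h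
  refine (tendsto_sum_Ico_rpow_mul (fun j => freeEnergyH 𝓑 n j D) one_pos hhM).congr' ?_
  filter_upwards [eventually_ge_atTop 1] with N hN
  have hN' : (0 : ℝ) < N := by exact_mod_cast hN
  rw [freeEnergy_eq_sum_range hM hN hD, ← Finset.sum_Ico_eq_sub _ hhM.le, Finset.mul_sum]
  refine Finset.sum_congr rfl fun j _ => ?_
  rw [← mul_assoc, ← Real.rpow_add hN']
  congr 2
  ring

theorem tendsto_freeEnergyH (h : ℕ) :
    Tendsto (fun D : ℕ => (D : ℝ) ^ (-((r : ℝ) + h)) * freeEnergyH 𝓑 n h D) atTop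
      (𝓝 (freeEnergyHL 𝓑 n h 0)) := by
  obtain ⟨M, hhM, hM⟩ := exists_isBound 𝓑 n 0
  refine (tendsto_sum_Ico_rpow_mul (fun l => freeEnergyHL 𝓑 n h l)
    (s := 1 / ((r : ℝ) + 1)) (by positivity) hhM).congr' ?_
  filter_upwards [eventually_ge_atTop 1] with D hD
  have hD' : (0 : ℝ) < D := by exact_mod_cast hD
  rw [freeEnergyH_eq_sum_range hM h hD, Finset.range_eq_Ico, Finset.mul_sum]
  refine Finset.sum_congr rfl fun j _ => ?_
  rw [← mul_assoc, ← Real.rpow_add hD']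
  congr 2
  push_cast
  ring

variable {𝓑 n}

/-- All the amplitudes are positive and have the same weight, hence there are no cancellations. -/
theorem tendsto_abs_freeEnergy_atTop (G : FeynmanGraph 𝓑 n) (hG : G.Connected) {N : ℕ}
    (hN : 1 ≤ N) {β : ℝ} (hβ : β < (r : ℝ) + G.h - G.ell / (r + 1)) :
    Tendsto (fun D : ℕ => (D : ℝ) ^ (-β) * |freeEnergy 𝓑 n N D|) atTop atTop := by
  classical
  have hN' : (0 : ℝ) < N := by exact_mod_cast hN
  have hc : 0 < |weight n| * (N : ℝ) ^ (2 - (G.h : ℝ)) :=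
    mul_pos (abs_pos.2 (weight_ne_zero n)) (Real.rpow_pos_of_pos hN' _)
  refine tendsto_atTop_mono' _ ?_ (((tendsto_rpow_atTop (sub_pos.2 hβ)).comp
    tendsto_natCast_atTop_atTop).const_mul_atTop hc)
  filter_upwards [eventually_ge_atTop 1] with D hD
  have hD' : (0 : ℝ) < D := by exact_mod_cast hD
  have hpos : ∀ G' : FeynmanGraph 𝓑 n, 0 ≤ G'.amplitude N D := by
    intro G'
    rw [G'.amplitude_eq hN hD]
    positivity
  have hle : G.amplitude N D ≤ ∑ G' : FeynmanGraph 𝓑 n with G'.Connected, G'.amplitude N D :=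
    Finset.single_le_sum (f := fun G' : FeynmanGraph 𝓑 n => G'.amplitude N D)
      (fun G' _ => hpos G') (Finset.mem_filter.2 ⟨Finset.mem_univ G, hG⟩)
  have habs : |freeEnergy 𝓑 n N D| =
      |weight n| * ∑ G' : FeynmanGraph 𝓑 n with G'.Connected, G'.amplitude N D := by
    unfold freeEnergy
    rw [abs_mul, abs_of_nonneg (Finset.sum_nonneg fun G' _ => hpos G')]
  rw [habs]
  calc |weight n| * (N : ℝ) ^ (2 - (G.h : ℝ)) * (D : ℝ) ^ ((r : ℝ) + G.h - G.ell / (r + 1) - β)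
      = (D : ℝ) ^ (-β) * (|weight n| * G.amplitude N D) := by
        rw [G.amplitude_eq hN hD, sub_eq_add_neg _ β, Real.rpow_add hD']
        ring
    _ ≤ _ := by gcongr

end Expansions

/-! ### Rings of tetrahedra -/

theorem Bubble.comp_eq_one_of_forall {C : Type} (B : Bubble C) (A : Set C) (o : B.V)
    (h : ∀ v, Quot.mk (fun v w : B.V => ∃ c ∈ A, B.edge c v = w) v = Quot.mk _ o) :
    B.comp A = 1 := by
  refine Nat.card_eq_one_iff_unique.2 ⟨⟨?_⟩, ⟨Quot.mk _ o⟩⟩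
  rintro ⟨v⟩ ⟨w⟩
  rw [h v, h w]

/-- Translation of the Klein four-group `Bool × Bool` by one of its non-trivial elements: one for
each matrix index, and their product for all the tensor indices. -/
def tetrahedronEdge : Colour r → Bool × Bool → Bool × Bool
  | Sum.inl 0, v => (!v.1, v.2)
  | Sum.inl 1, v => (v.1, !v.2)
  | Sum.inr _, v => (!v.1, !v.2)

/-- The complete graph on four vertices, with the edges of each of its three perfect matchings
in a different colour; the third one carries all the tensor colours. -/
def tetrahedron (r : ℕ) : Bubble (Colour r) where
  V := Bool × Bool
  edge := tetrahedronEdge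
  edge_edge c v := by
    rcases c with c | c
    · fin_cases c <;> simp [tetrahedronEdge]
    · simp [tetrahedronEdge]
  edge_ne c v := by
    rcases v with ⟨x, y⟩
    rcases c with c | c
    · fin_cases c <;> simp [tetrahedronEdge]
    · simp [tetrahedronEdge]

theorem card_V_tetrahedron : Nat.card (tetrahedron r).V = 4 := by
  change Nat.card (Bool × Bool) = 4
  simp

theorem comp_tetrahedron_eq_one {A : Set (Colour r)} {a b : Colour r} (ha : a ∈ A) (hb : b ∈ A)
    (h : ∀ v : Bool × Bool, v = (false, false) ∨ v = tetrahedronEdge a (false, false) ∨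
      v = tetrahedronEdge b (false, false) ∨
      v = tetrahedronEdge a (tetrahedronEdge b (false, false))) :
    (tetrahedron r).comp A = 1 := by
  refine (tetrahedron r).comp_eq_one_of_forall A (false, false) fun v => ?_
  have key : ∀ c ∈ A, ∀ w : Bool × Bool,
      Quot.mk (fun v w : (tetrahedron r).V => ∃ c ∈ A, (tetrahedron r).edge c v = w)
        (tetrahedronEdge c w) = Quot.mk _ w := fun c hc w => (Quot.sound ⟨c, hc, rfl⟩).symm
  rcases h v with rfl | rfl | rfl | rfl
  · rfl
  · exact key a ha _
  · exact key b hb _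
  · exact (key a ha _).trans (key b hb _)

theorem faces_tetrahedron_inl_inl : (tetrahedron r).faces (Sum.inl 0) (Sum.inl 1) = 1 :=
  comp_tetrahedron_eq_one (a := Sum.inl 0) (b := Sum.inl 1) (by simp) (by simp) (by
    rintro ⟨_ | _, _ | _⟩ <;> simp [tetrahedronEdge])

theorem faces_tetrahedron_inl_inr (i : Fin 2) (m : Fin r) :
    (tetrahedron r).faces (Sum.inl i) (Sum.inr m) = 1 :=
  comp_tetrahedron_eq_one (a := Sum.inl i) (b := Sum.inr m) (by simp) (by simp) (by
    fin_cases i <;> rintro ⟨_ | _, _ | _⟩ <;> simp [tetrahedronEdge])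

/-- Two tensor colours are parallel, so their faces are the edges of either of them. -/
theorem faces_tetrahedron_inr_inr (m m' : Fin r) :
    (tetrahedron r).faces (Sum.inr m) (Sum.inr m') = 2 := by
  have h := (tetrahedron r).two_mul_comp_singleton (Sum.inr m)
  rw [card_V_tetrahedron] at h
  have e : (tetrahedron r).faces (Sum.inr m) (Sum.inr m') =
      (tetrahedron r).comp {Sum.inr m} := by
    unfold Bubble.faces Bubble.comp
    congr! 4 with v w
    constructor
    · rintro ⟨c, rfl | rfl, h⟩ <;> exact ⟨_, rfl, h⟩
    · rintro ⟨c, rfl, h⟩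
      exact ⟨_, Or.inl rfl, h⟩
  omega

theorem facesSum_tetrahedron : (tetrahedron r).facesSum = 2 * ((r : ℝ) ^ 2 + r + 1) := by
  have e1 : (tetrahedron r).faces (Sum.inl 0) (Sum.inl 0) = 2 := by
    have h := (tetrahedron r).two_mul_comp_singleton (Sum.inl 0)
    rw [card_V_tetrahedron] at h
    rw [Bubble.faces, Set.pair_eq_singleton]
    omega
  have e2 : (tetrahedron r).faces (Sum.inl 1) (Sum.inl 1) = 2 := by
    have h := (tetrahedron r).two_mul_comp_singleton (Sum.inl 1)
    rw [card_V_tetrahedron] at h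
    rw [Bubble.faces, Set.pair_eq_singleton]
    omega
  have e3 : (tetrahedron r).faces (Sum.inl 1) (Sum.inl 0) = 1 := by
    rw [Bubble.faces_comm, faces_tetrahedron_inl_inl]
  rw [Bubble.facesSum_eq]
  simp only [Finset.sum_erase_eq_sub (Finset.mem_univ _), Finset.sum_sub_distrib,
    Fintype.sum_sum_type, Fin.sum_univ_two, faces_tetrahedron_inl_inl, faces_tetrahedron_inl_inr,
    faces_tetrahedron_inr_inr,
    Bubble.faces_comm _ (Sum.inr _) (Sum.inl _), e1, e2, e3, Finset.sum_const, Finset.card_univ,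
    Fintype.card_fin, nsmul_eq_mul]
  push_cast
  ring

section Necklace

variable {n : Unit →₀ ℕ} (π : Equiv.Perm (Vertices n))

/-- Around each interaction vertex, two fields not adjacent through matrix indices are contracted
with each other, and the other two are contracted with the neighbouring interaction vertices in the
cyclic order `π`. -/
def necklaceWick : (Σ _ : Vertices n, Bool × Bool) → Σ _ : Vertices n, Bool × Bool
  | ⟨i, (false, false)⟩ => ⟨i, (true, true)⟩
  | ⟨i, (true, true)⟩ => ⟨i, (false, false)⟩
  | ⟨i, (true, false)⟩ => ⟨π i, (false, true)⟩
  | ⟨i, (false, true)⟩ => ⟨π⁻¹ i, (true, false)⟩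

theorem necklaceWick_necklaceWick (x : Σ _ : Vertices n, Bool × Bool) :
    necklaceWick π (necklaceWick π x) = x := by
  rcases x with ⟨i, _ | _, _ | _⟩ <;> simp [necklaceWick]

theorem necklaceWick_ne (x : Σ _ : Vertices n, Bool × Bool) : necklaceWick π x ≠ x := by
  rcases x with ⟨i, _ | _, _ | _⟩ <;> simp [necklaceWick]

/-- A closed ring of tetrahedra. Its subgraph with the matrix colours and `0` is a connected sum of
projective planes, one for each tetrahedron; this is the only contribution to `ℓ`. -/
def necklace (r : ℕ) : FeynmanGraph (fun _ : Unit => tetrahedron r) n where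
  wick := necklaceWick π
  wick_wick := necklaceWick_necklaceWick π
  wick_ne := necklaceWick_ne π

theorem eq_of_forall_apply_eq (hπ : π.IsCycleOn Set.univ) {X : Type} (q : Vertices n → X)
    (hq : ∀ i, q (π i) = q i) (i j : Vertices n) : q i = q j := by
  obtain ⟨m, rfl⟩ := (hπ.2 (Set.mem_univ i) (Set.mem_univ j)).exists_nat_pow_eq
  induction m with
  | zero => rfl
  | succ m ih => rw [pow_succ', Equiv.Perm.mul_apply, hq, ← ih]

variable {π}

theorem connected_necklace (hπ : π.IsCycleOn Set.univ) (i₀ : Vertices n) :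
    (necklace π r).Connected := by
  refine Nat.card_eq_one_iff_unique.2 ⟨⟨?_⟩, ⟨Quot.mk _ i₀⟩⟩
  rintro ⟨i⟩ ⟨j⟩
  exact eq_of_forall_apply_eq π hπ (fun i => Quot.mk _ i)
    (fun i => (Quot.sound ⟨⟨i, (true, false)⟩, rfl, rfl⟩).symm) i j

/-- A strand carrying a matrix index runs once through all the tetrahedra of the ring. -/
theorem faces_necklace_inl (hπ : π.IsCycleOn Set.univ) (i₀ : Vertices n) (c : Fin 2) :
    (necklace π r).bubble.faces none (some (Sum.inl c)) = 1 := by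
  let R : (Σ _ : Vertices n, Bool × Bool) → (Σ _ : Vertices n, Bool × Bool) → Prop := fun v w =>
    ∃ e ∈ ({none, some (Sum.inl c)} : Set (Option (Colour r))), (necklace π r).bubble.edge e v = w
  have h0 : ∀ x, Quot.mk R x = Quot.mk R (necklaceWick π x) :=
    fun x => Quot.sound ⟨none, by simp, rfl⟩
  have hc : ∀ i v, Quot.mk R ⟨i, v⟩ = Quot.mk R ⟨i, tetrahedronEdge (Sum.inl c : Colour r) v⟩ :=
    fun i v => Quot.sound ⟨some (Sum.inl c), by simp, rfl⟩
  have h2 : ∀ i, Quot.mk R ⟨i, (false, false)⟩ = Quot.mk R ⟨i, (true, true)⟩ := fun i => h0 _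
  have h3 : ∀ i, Quot.mk R ⟨π i, (false, true)⟩ = Quot.mk R ⟨i, (true, false)⟩ :=
    fun i => (h0 ⟨i, (true, false)⟩).symm
  -- the strand traverses all the fields of a tetrahedron before leaving it
  have h1 : ∀ i v, Quot.mk R ⟨i, v⟩ = Quot.mk R ⟨i, (true, false)⟩ := by
    intro i
    have hTF := hc i (true, false)
    have hFT := hc i (false, true)
    have h2 := h2 i
    fin_cases c
    · change _ = Quot.mk R ⟨i, (false, false)⟩ at hTF
      change _ = Quot.mk R ⟨i, (true, true)⟩ at hFT
      rintro ⟨_ | _, _ | _⟩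
      · rw [hTF]
      · rw [hFT, hTF, h2]
      · rfl
      · rw [hTF, h2]
    · change _ = Quot.mk R ⟨i, (true, true)⟩ at hTF
      change _ = Quot.mk R ⟨i, (false, false)⟩ at hFT
      rintro ⟨_ | _, _ | _⟩
      · rw [hTF, h2]
      · rw [hFT, hTF, h2]
      · rfl
      · rw [hTF]
  refine (necklace π r).bubble.comp_eq_one_of_forall _ ⟨i₀, (true, false)⟩ ?_
  rintro ⟨i, v⟩
  exact (h1 i v).trans (eq_of_forall_apply_eq π hπ (fun i => Quot.mk R ⟨i, (true, false)⟩)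
    (fun i => (h1 (π i) _).symm.trans (h3 i)) i i₀)

/-- One face of length two for each tetrahedron, and one more running around the ring. -/
theorem faces_necklace_inr (hπ : π.IsCycleOn Set.univ) (i₀ : Vertices n) (m : Fin r) :
    (necklace π r).bubble.faces none (some (Sum.inr m)) = Nat.card (Vertices n) + 1 := by
  let R : (Σ _ : Vertices n, Bool × Bool) → (Σ _ : Vertices n, Bool × Bool) → Prop := fun v w =>
    ∃ e ∈ ({none, some (Sum.inr m)} : Set (Option (Colour r))), (necklace π r).bubble.edge e v = w
  have h0 : ∀ x, Quot.mk R x = Quot.mk R (necklaceWick π x) :=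
    fun x => Quot.sound ⟨none, by simp, rfl⟩
  have hm : ∀ i v, Quot.mk R ⟨i, v⟩ = Quot.mk R ⟨i, tetrahedronEdge (Sum.inr m : Colour r) v⟩ :=
    fun i v => Quot.sound ⟨some (Sum.inr m), by simp, rfl⟩
  have h2 : ∀ i, Quot.mk R ⟨i, (true, true)⟩ = Quot.mk R ⟨i, (false, false)⟩ := fun i => h0 _
  have h3 : ∀ i, Quot.mk R ⟨π i, (false, true)⟩ = Quot.mk R ⟨i, (true, false)⟩ :=
    fun i => (h0 ⟨i, (true, false)⟩).symm
  have h4 : ∀ i, Quot.mk R ⟨i, (false, true)⟩ = Quot.mk R ⟨i, (true, false)⟩ := fun i => hm _ _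
  have h5 : ∀ i, Quot.mk R ⟨i, (true, false)⟩ = Quot.mk R ⟨i₀, (true, false)⟩ := fun i =>
    eq_of_forall_apply_eq π hπ (fun i => Quot.mk R ⟨i, (true, false)⟩)
      (fun i => (h4 (π i)).symm.trans (h3 i)) i i₀
  -- `some i` stands for the short face at `i`, and `none` for the long one
  let F : (Σ _ : Vertices n, Bool × Bool) → Option (Vertices n) :=
    fun x => if x.2.1 = x.2.2 then some x.1 else none
  rw [← Finite.card_option]
  refine Nat.card_congr (α := Quot R)
    { toFun := Quot.lift F ?_
      invFun := fun y => y.elim (Quot.mk R ⟨i₀, (true, false)⟩)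
        fun i => Quot.mk R ⟨i, (false, false)⟩
      left_inv := ?_
      right_inv := ?_ }
  · rintro ⟨i, _ | _, _ | _⟩ _ ⟨e, rfl | rfl, rfl⟩ <;> rfl
  · rintro ⟨⟨i, _ | _, _ | _⟩⟩
    · rfl
    · exact ((h4 i).trans (h5 i)).symm
    · exact (h5 i).symm
    · exact (h2 i).symm
  · rintro (_ | i) <;> rfl

theorem p_necklace : (necklace π r).p = 2 * Nat.card (Vertices n) := by
  have h := (necklace π r).two_mul_p
  rw [FeynmanGraph.card_fields] at h
  simp only [card_V_tetrahedron, Finset.sum_const, Finset.card_univ, smul_eq_mul] at h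
  rw [Nat.card_eq_fintype_card]
  omega

theorem f_necklace (hπ : π.IsCycleOn Set.univ) (i₀ : Vertices n) :
    (necklace π r).f = 2 := by
  unfold FeynmanGraph.f
  simp [faces_necklace_inl hπ i₀]

theorem h_necklace (hπ : π.IsCycleOn Set.univ) (i₀ : Vertices n) :
    (necklace π r).h = Nat.card (Vertices n) := by
  unfold FeynmanGraph.h
  rw [p_necklace, f_necklace hπ i₀]
  simp only [Bubble.traces, faces_tetrahedron_inl_inl, Finset.sum_const, Finset.card_univ,
    nsmul_eq_mul, Nat.card_eq_fintype_card]
  push_cast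
  ring

theorem ell_necklace (hπ : π.IsCycleOn Set.univ) (i₀ : Vertices n) :
    (necklace π r).ell = Nat.card (Vertices n) := by
  rw [FeynmanGraph.ell_eq, FeynmanGraph.facesSum_restrict_bubble, p_necklace,
    Fintype.sum_sum_type]
  simp only [faces_necklace_inl hπ i₀, faces_necklace_inr hπ i₀, facesSum_tetrahedron,
    Finset.sum_const, Finset.card_univ, Fintype.card_fin, nsmul_eq_mul, Nat.card_eq_fintype_card]
  push_cast
  ring

end Necklace

theorem card_vertices_single (k : ℕ) : Nat.card (Vertices (Finsupp.single () k)) = k := by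
  rw [Nat.card_eq_fintype_card, Fintype.card_sigma]
  simp only [Fintype.card_fin]
  rw [Finset.sum_coe_sort (Finsupp.single () k).support fun a => Finsupp.single () k a]
  exact Finsupp.sum_single_index (h := fun _ m => m) rfl

theorem exists_connected_h_eq_ell_eq {k : ℕ} (hk : 1 ≤ k) :
    ∃ G : FeynmanGraph (fun _ : Unit => tetrahedron r) (Finsupp.single () k),
      G.Connected ∧ G.h = k ∧ G.ell = k := by
  have hcard := card_vertices_single k
  have hne : Nonempty (Vertices (Finsupp.single () k)) :=
    Finite.card_pos_iff.1 (by omega)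
  obtain ⟨i₀⟩ := hne
  obtain ⟨π, hπ, -⟩ :=
    (Set.countable_univ (α := Vertices (Finsupp.single () k))).exists_cycleOn
  refine ⟨necklace π r, connected_necklace hπ i₀, ?_, ?_⟩
  · rw [h_necklace hπ i₀, hcard]
  · rw [ell_necklace hπ i₀, hcard]

end MatTens

open MatTens
theorem mainTheorem5 (r : ℕ) (hr : 1 ≤ r) :
    -- an arbitrary model, with an arbitrary set of interaction bubbles
    (∀ (S : Type) (𝓑 : S → Bubble (Colour r)),
      -- connected Feynman graphs
      (∀ (n : S →₀ ℕ) (G : FeynmanGraph 𝓑 n), G.Connected →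
        (∀ N D : ℕ, 1 ≤ N → 1 ≤ D →
          G.amplitude N D =
            (N : ℝ) ^ (2 - (G.h : ℝ)) * (D : ℝ) ^ ((r : ℝ) + G.h - G.ell / (r + 1))) ∧
        0 ≤ G.h ∧
        G.ell = 2 * G.bubble.ind0 + ((r : ℝ) + 1) * (r + 2) *
          (1 + ∑ i : Vertices n, (((𝓑 i.1).numComponents : ℝ) - 1) - G.bubble.numComponents) ∧
        0 ≤ G.ell ∧
        (∃ l : ℕ, G.ell = l) ∧
        (r : ℝ) + G.h - G.ell / (r + 1) ≤ r + G.h) ∧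
      -- the large `N` expansion, and the large `D` expansion at each of its orders
      (∀ n : S →₀ ℕ,
        {q : ℕ × ℕ | freeEnergyHL 𝓑 n q.1 q.2 ≠ 0}.Finite ∧
        (∀ N D : ℕ, 1 ≤ N → 1 ≤ D →
          freeEnergy 𝓑 n N D = ∑ᶠ h : ℕ, (N : ℝ) ^ (2 - (h : ℝ)) * freeEnergyH 𝓑 n h D) ∧
        (∀ h D : ℕ, 1 ≤ D →
          freeEnergyH 𝓑 n h D =
            ∑ᶠ l : ℕ, (D : ℝ) ^ ((r : ℝ) + h - l / (r + 1)) * freeEnergyHL 𝓑 n h l) ∧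
        (∀ h D : ℕ, 1 ≤ D →
          Tendsto (fun N : ℕ => (N : ℝ) ^ ((h : ℝ) - 2) *
              (freeEnergy 𝓑 n N D -
                ∑ j ∈ Finset.range h, (N : ℝ) ^ (2 - (j : ℝ)) * freeEnergyH 𝓑 n j D))
            atTop (𝓝 (freeEnergyH 𝓑 n h D))) ∧
        (∀ h : ℕ,
          Tendsto (fun D : ℕ => (D : ℝ) ^ (-((r : ℝ) + h)) * freeEnergyH 𝓑 n h D) atTop
            (𝓝 (freeEnergyHL 𝓑 n h 0)))) ∧
      -- at fixed `N`, the contribution of a connected graph to the growth in `D` is not cancelled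
      (∀ (n : S →₀ ℕ) (G : FeynmanGraph 𝓑 n), G.Connected →
        ∀ N : ℕ, 1 ≤ N → ∀ β : ℝ, β < (r : ℝ) + G.h - G.ell / (r + 1) →
          Tendsto (fun D : ℕ => (D : ℝ) ^ (-β) * |freeEnergy 𝓑 n N D|) atTop atTop)) ∧
    -- the two limits do not commute: at fixed `N` the power of `D` grows linearly with `h`
    (∃ B : Bubble (Colour r), B.traces = 1 ∧
      ∀ k : ℕ, 1 ≤ k →
        (∃ G : FeynmanGraph (fun _ : Unit => B) (Finsupp.single () k),
          G.Connected ∧ G.h = k ∧ G.ell = k) ∧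
        ∀ N : ℕ, 1 ≤ N →
          Tendsto (fun D : ℕ => (D : ℝ) ^ (-(r : ℝ)) *
            |(N : ℝ) ^ (-2 : ℝ) * freeEnergy (fun _ : Unit => B) (Finsupp.single () k) N D|)
            atTop atTop) := by
  refine ⟨fun S 𝓑 => ⟨fun n G hG => ?_, fun n => ?_, fun n G hG N hN β hβ => ?_⟩, ?_⟩
  · obtain ⟨l, hl⟩ := G.exists_ell_eq_natCast hG
    have hl0 : 0 ≤ G.ell := hl ▸ Nat.cast_nonneg l
    refine ⟨fun N D hN hD => G.amplitude_eq hN hD, G.h_nonneg hG, G.ell_eq_ind0 hr, hl0, ⟨l, hl⟩,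
      ?_⟩
    have : 0 ≤ G.ell / ((r : ℝ) + 1) := by positivity
    linarith
  · exact ⟨finite_setOf_freeEnergyHL_ne_zero 𝓑 n,
      fun N D hN hD => freeEnergy_eq_finsum 𝓑 n hN hD,
      fun h D hD => freeEnergyH_eq_finsum 𝓑 n h hD,
      fun h D hD => tendsto_freeEnergy 𝓑 n h hD,
      fun h => tendsto_freeEnergyH 𝓑 n h⟩
  · exact tendsto_abs_freeEnergy_atTop G hG hN hβ
  · refine ⟨tetrahedron r, faces_tetrahedron_inl_inl, fun k hk =>
      ⟨exists_connected_h_eq_ell_eq hk, fun N hN => ?_⟩⟩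
    obtain ⟨G, hG, hh, hl⟩ := exists_connected_h_eq_ell_eq (r := r) hk
    have hN' : (0 : ℝ) < N := by exact_mod_cast hN
    -- the power of `D` is `r + k - k / (r + 1)`, and `k / (r + 1) < k` because `r ≥ 1`
    have hβ : (r : ℝ) < (r : ℝ) + G.h - G.ell / (r + 1) := by
      have hk' : (0 : ℝ) < k := by exact_mod_cast hk
      have hr' : (1 : ℝ) < (r : ℝ) + 1 := by
        have : (1 : ℝ) ≤ r := by exact_mod_cast hr
        linarith
      have := div_lt_self hk' hr'
      rw [hh, hl]
      push_cast
      linarith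
    refine ((tendsto_abs_freeEnergy_atTop G hG hN hβ).const_mul_atTop
      (Real.rpow_pos_of_pos hN' (-2))).congr fun D => ?_
    rw [abs_mul, abs_of_pos (Real.rpow_pos_of_pos hN' _)]
    ring
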